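/- All Banach spaces and Banach lattices are real; for a Banach space $E$, $B_E$ and $S_E$ denote its closed unit ball and its unit sphere. Let $X\neq\{0\}$ be a Banach lattice such that for every $n\ge 1$, all $x_1,\dots,x_n\in S_X$ and every $\varepsilon>0$ there is $x\in S_X$ with $x\ge 0$ and $\|x_i\pm x\|\le 1+\varepsilon$ for $1\le i\le n$ (that is, $X$ is ASQ$_+$). Let $Y$ be an AL-space, that is, a Banach lattice with $\|y+y'\|=\|y\|+\|y'\|$ for all $y,y'\ge 0$, and suppose that there is $y^*\in S_{Y^*}$ with $n(Y^*,y^*)=1$, where, for a Banach space $E$ and $u\in S_E$, $n(E,u)$ is the largest real $r\ge 0$ such that $$r\|v\|\le\sup\{|f(v)| : f\in S_{E^*},\ f(u)=1\}\qquad\text{for all } v\in E .$$ Then the projective tensor product $Z=X\widehat{\otimes}_\pi Y$, ordered by the closed convex cone generated by the tensors $x\otimes y$ with $x\in X$, $y\in Y$, $x,y\ge 0$, is a Banach lattice, and it is LASQ$_+$: for every $u\in S_Z$ and $\varepsilon>0$ there is $z\in S_Z$ with $z\ge 0$ and $\|u\pm z\|\le 1+\varepsilon$. Moreover, $Z$ has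 the diameter two property: every non-empty relatively weakly open subset of $B_Z$ has diameter $2$. -/

import Mathlib

open scoped TensorProduct

noncomputable section

/-- `E` is a (real) Banach lattice: the order, given by the lattice structure, is a vector order,
the norm is a lattice norm (`|x| ≤ |y|` implies `‖x‖ ≤ ‖y‖`), and `E` is complete. -/
class IsBanachLattice (E : Type*) [NormedAddCommGroup E] [NormedSpace ℝ E] [Lattice E] : Prop
    extends IsOrderedAddMonoid E, IsOrderedModule ℝ E, HasSolidNorm E, CompleteSpace E

/-- The Banach lattice `E` is an AL-space: the norm is additive on the positive cone. -/
def IsALSpace (E : Type*) [NormedAddCommGroup E] [Lattice E] : Prop :=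
  ∀ x y : E, 0 ≤ x → 0 ≤ y → ‖x + y‖ = ‖x‖ + ‖y‖

/-- `E` is LASQ₊: for every `y` in the unit sphere and every `ε > 0` there is a positive `x` in the
unit sphere with `‖y ± x‖ ≤ 1 + ε`. -/
def IsLASQPlus (E : Type*) [NormedAddCommGroup E] [Lattice E] : Prop :=
  ∀ y : E, ‖y‖ = 1 → ∀ ε : ℝ, 0 < ε →
    ∃ x : E, 0 ≤ x ∧ ‖x‖ = 1 ∧ ‖y + x‖ ≤ 1 + ε ∧ ‖y - x‖ ≤ 1 + ε

/-- `E` is ASQ₊: for all `y₁, …, yₙ` (`n ≥ 1`) in the unit sphere and every `ε > 0` there is a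
positive `x` in the unit sphere with `‖yᵢ ± x‖ ≤ 1 + ε` for all `i`. -/
def IsASQPlus (E : Type*) [NormedAddCommGroup E] [Lattice E] : Prop :=
  ∀ n : ℕ, 0 < n → ∀ y : Fin n → E, (∀ i, ‖y i‖ = 1) → ∀ ε : ℝ, 0 < ε →
    ∃ x : E, 0 ≤ x ∧ ‖x‖ = 1 ∧ ∀ i, ‖y i + x‖ ≤ 1 + ε ∧ ‖y i - x‖ ≤ 1 + ε

/-- The diameter two property: every non-empty relatively weakly open subset of the closed unit
ball has diameter `2`. -/
def HasDiameterTwoProperty (E : Type*) [NormedAddCommGroup E] [NormedSpace ℝ E] : Prop :=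
  ∀ U : Set (WeakSpace ℝ E), IsOpen U →
    (Metric.closedBall (0 : E) 1 ∩ toWeakSpace ℝ E ⁻¹' U).Nonempty →
    Metric.diam (Metric.closedBall (0 : E) 1 ∩ toWeakSpace ℝ E ⁻¹' U) = 2

/-- The set of all real `r ≥ 0` such that
`r ‖x‖ ≤ sup {|f x| : f a norm-one functional with f u = 1}` for all `x`. -/
def numericalIndexSet {E : Type*} [NormedAddCommGroup E] [NormedSpace ℝ E] (u : E) : Set ℝ :=
  {r : ℝ | 0 ≤ r ∧ ∀ x : E,
    r * ‖x‖ ≤ sSup {s : ℝ | ∃ f : StrongDual ℝ E, ‖f‖ = 1 ∧ f u = 1 ∧ s = |f x|}}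

/-- The numerical index `n(E, u)` of `E` with respect to `u` in the unit sphere: the largest
`r ≥ 0` with `r ‖x‖ ≤ sup {|f x| : f a norm-one functional with f u = 1}` for all `x`. -/
def numericalIndex {E : Type*} [NormedAddCommGroup E] [NormedSpace ℝ E] (u : E) : ℝ :=
  sSup (numericalIndexSet u)

/-- For `u` in the unit sphere, the largest element in the definition of `n(E, u)` exists. -/
theorem isGreatest_numericalIndex {E : Type*} [NormedAddCommGroup E] [NormedSpace ℝ E] (u : E)
    (hu : ‖u‖ = 1) : IsGreatest (numericalIndexSet u) (numericalIndex u) := by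
  have hnn : ∀ x : E,
      0 ≤ sSup {s : ℝ | ∃ f : StrongDual ℝ E, ‖f‖ = 1 ∧ f u = 1 ∧ s = |f x|} := by
    intro x
    refine Real.sSup_nonneg ?_
    rintro s ⟨f, -, -, rfl⟩
    exact abs_nonneg _
  have hle : ∀ x : E,
      sSup {s : ℝ | ∃ f : StrongDual ℝ E, ‖f‖ = 1 ∧ f u = 1 ∧ s = |f x|} ≤ ‖x‖ := by
    intro x
    refine Real.sSup_le ?_ (norm_nonneg _)
    rintro s ⟨f, hf, -, rfl⟩
    simpa [hf] using f.le_opNorm x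
  have hbdd : BddAbove (numericalIndexSet u) := by
    refine ⟨1, ?_⟩
    rintro r ⟨-, h⟩
    have := (h u).trans (hle u)
    simpa [hu] using this
  have hne : (numericalIndexSet u).Nonempty := ⟨0, le_rfl, fun x => by simpa using hnn x⟩
  refine ⟨⟨?_, fun x => ?_⟩, fun r hr => le_csSup hbdd hr⟩
  · exact Real.sSup_nonneg fun r hr => hr.1
  · rcases (norm_nonneg x).eq_or_lt with h0 | hpos
    · rw [← h0, mul_zero]
      exact hnn x
    · rw [← le_div_iff₀ hpos]
      refine csSup_le hne fun r hr => ?_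
      rw [le_div_iff₀ hpos]
      exact hr.2 x

section ProjectiveTensorProduct

variable (X Y : Type*) [NormedAddCommGroup X] [NormedSpace ℝ X]
  [NormedAddCommGroup Y] [NormedSpace ℝ Y]

/-- The costs `∑ ‖xᵢ‖ ‖yᵢ‖` of all the finite representations `u = ∑ xᵢ ⊗ yᵢ`. -/
def projectiveCosts {X Y : Type*} [NormedAddCommGroup X] [NormedSpace ℝ X]
    [NormedAddCommGroup Y] [NormedSpace ℝ Y] (u : X ⊗[ℝ] Y) : Set ℝ :=
  {r : ℝ | ∃ l : List (X × Y), (l.map fun p => p.1 ⊗ₜ[ℝ] p.2).sum = u ∧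
    (l.map fun p => ‖p.1‖ * ‖p.2‖).sum = r}

theorem projectiveCosts_nonneg {X Y : Type*} [NormedAddCommGroup X] [NormedSpace ℝ X]
    [NormedAddCommGroup Y] [NormedSpace ℝ Y] {u : X ⊗[ℝ] Y} {r : ℝ}
    (hr : r ∈ projectiveCosts u) : 0 ≤ r := by
  obtain ⟨l, -, rfl⟩ := hr
  refine List.sum_nonneg fun a ha => ?_
  obtain ⟨p, -, rfl⟩ := List.mem_map.1 ha
  positivity

theorem projectiveCosts_bddBelow {X Y : Type*} [NormedAddCommGroup X] [NormedSpace ℝ X]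
    [NormedAddCommGroup Y] [NormedSpace ℝ Y] (u : X ⊗[ℝ] Y) : BddBelow (projectiveCosts u) :=
  ⟨0, fun _ hr => projectiveCosts_nonneg hr⟩

theorem projectiveCosts_add {X Y : Type*} [NormedAddCommGroup X] [NormedSpace ℝ X]
    [NormedAddCommGroup Y] [NormedSpace ℝ Y] {u v : X ⊗[ℝ] Y} {r s : ℝ}
    (hr : r ∈ projectiveCosts u) (hs : s ∈ projectiveCosts v) :
    r + s ∈ projectiveCosts (u + v) := by
  obtain ⟨l, rfl, rfl⟩ := hr
  obtain ⟨m, rfl, rfl⟩ := hs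
  exact ⟨l ++ m, by simp, by simp⟩

theorem projectiveCosts_smul {X Y : Type*} [NormedAddCommGroup X] [NormedSpace ℝ X]
    [NormedAddCommGroup Y] [NormedSpace ℝ Y] {u : X ⊗[ℝ] Y} {r : ℝ} (a : ℝ)
    (hr : r ∈ projectiveCosts u) : ‖a‖ * r ∈ projectiveCosts (a • u) := by
  obtain ⟨l, rfl, rfl⟩ := hr
  refine ⟨l.map fun p => (a • p.1, p.2), ?_, ?_⟩
  · simp [List.smul_sum, Function.comp_def, TensorProduct.smul_tmul']
  · simp [Function.comp_def, norm_smul, mul_assoc, List.sum_map_mul_left]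

theorem projectiveCosts_nonempty {X Y : Type*} [NormedAddCommGroup X] [NormedSpace ℝ X]
    [NormedAddCommGroup Y] [NormedSpace ℝ Y] (u : X ⊗[ℝ] Y) : (projectiveCosts u).Nonempty := by
  induction u using TensorProduct.induction_on with
  | zero => exact ⟨0, [], by simp, by simp⟩
  | tmul x y => exact ⟨‖x‖ * ‖y‖, [(x, y)], by simp, by simp⟩
  | add u v hu hv =>
    obtain ⟨r, hr⟩ := hu
    obtain ⟨s, hs⟩ := hv
    exact ⟨r + s, projectiveCosts_add hr hs⟩

/-- The projective (semi)norm `π(u) = inf {∑ ‖xᵢ‖ ‖yᵢ‖ : u = ∑ xᵢ ⊗ yᵢ}`. -/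
def projectiveSeminorm : Seminorm ℝ (X ⊗[ℝ] Y) :=
  Seminorm.ofSMulLE (fun u => sInf (projectiveCosts u))
    (le_antisymm (csInf_le (projectiveCosts_bddBelow _) ⟨[], by simp, by simp⟩)
      (Real.sInf_nonneg fun _ hr => projectiveCosts_nonneg hr))
    (fun u v => by
      refine le_of_forall_pos_le_add fun ε hε => ?_
      obtain ⟨r, hr, hr'⟩ := Real.lt_sInf_add_pos (projectiveCosts_nonempty u) (half_pos hε)
      obtain ⟨s, hs, hs'⟩ := Real.lt_sInf_add_pos (projectiveCosts_nonempty v) (half_pos hε)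
      have := csInf_le (projectiveCosts_bddBelow _) (projectiveCosts_add hr hs)
      linarith)
    (fun a u => by
      rw [← smul_eq_mul, ← Real.sInf_smul_of_nonneg (norm_nonneg a)]
      refine le_csInf ((projectiveCosts_nonempty u).smul_set) ?_
      rintro _ ⟨r, hr, rfl⟩
      exact csInf_le (projectiveCosts_bddBelow _) (projectiveCosts_smul a hr))

/-- The algebraic tensor product of `X` and `Y`, to be equipped with the projective norm. -/
def AlgProjTensor : Type _ := X ⊗[ℝ] Y

instance AlgProjTensor.instSeminormedAddCommGroup : SeminormedAddCommGroup (AlgProjTensor X Y) :=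
  AddGroupSeminorm.toSeminormedAddCommGroup (E := X ⊗[ℝ] Y)
    (projectiveSeminorm X Y).toAddGroupSeminorm

instance AlgProjTensor.instModule : Module ℝ (AlgProjTensor X Y) :=
  inferInstanceAs (Module ℝ (X ⊗[ℝ] Y))

instance AlgProjTensor.instNormedSpace : NormedSpace ℝ (AlgProjTensor X Y) where
  norm_smul_le a u := (map_smul_eq_mul (projectiveSeminorm X Y) a u).le

/-- The identity map from the algebraic tensor product to its copy with the projective norm. -/
def AlgProjTensor.of : X ⊗[ℝ] Y ≃ₗ[ℝ] AlgProjTensor X Y :=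
  LinearEquiv.refl ℝ (X ⊗[ℝ] Y)

theorem AlgProjTensor.norm_of {X Y : Type*} [NormedAddCommGroup X] [NormedSpace ℝ X]
    [NormedAddCommGroup Y] [NormedSpace ℝ Y] (u : X ⊗[ℝ] Y) :
    ‖AlgProjTensor.of X Y u‖ = sInf (projectiveCosts u) := rfl

/-- The projective tensor product of `X` and `Y`: the completion of the algebraic tensor product
with respect to the projective norm. -/
def ProjTensor : Type _ := UniformSpace.Completion (AlgProjTensor X Y)

instance ProjTensor.instNormedAddCommGroup : NormedAddCommGroup (ProjTensor X Y) :=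
  inferInstanceAs (NormedAddCommGroup (UniformSpace.Completion (AlgProjTensor X Y)))

instance ProjTensor.instNormedSpace : NormedSpace ℝ (ProjTensor X Y) :=
  inferInstanceAs (NormedSpace ℝ (UniformSpace.Completion (AlgProjTensor X Y)))

instance ProjTensor.instCompleteSpace : CompleteSpace (ProjTensor X Y) :=
  inferInstanceAs (CompleteSpace (UniformSpace.Completion (AlgProjTensor X Y)))

/-- The canonical isometric linear map of the algebraic tensor product into its completion. -/
def ProjTensor.ofAlg : AlgProjTensor X Y →ₗᵢ[ℝ] ProjTensor X Y :=
  UniformSpace.Completion.toComplₗᵢ (𝕜 := ℝ) (E := AlgProjTensor X Y)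

/-- The elementary tensor `x ⊗ y` as an element of the projective tensor product. -/
def ProjTensor.tmul {X Y : Type*} [NormedAddCommGroup X] [NormedSpace ℝ X]
    [NormedAddCommGroup Y] [NormedSpace ℝ Y] (x : X) (y : Y) : ProjTensor X Y :=
  ProjTensor.ofAlg X Y (AlgProjTensor.of X Y (x ⊗ₜ[ℝ] y))

/-- The positive cone of the projective tensor product of two Banach lattices: the closure of the
set of all finite sums of tensors `x ⊗ y` with `x, y ≥ 0`, that is, the closed convex cone
generated by these tensors. -/
def ProjTensor.positiveCone [Lattice X] [Lattice Y] : Set (ProjTensor X Y) :=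
  closure (AddSubmonoid.closure
    {z : ProjTensor X Y | ∃ (x : X) (y : Y), 0 ≤ x ∧ 0 ≤ y ∧ z = ProjTensor.tmul x y} :
      Set (ProjTensor X Y))

end ProjectiveTensorProduct

end

noncomputable section

/-! ### Disjoint families and simultaneous Freudenthal approximation in an AL-space. -/

section ALSpace

open Filter Topology

/-! Heuristically `Y` is an `L₁(μ)` and `Z` is the Bochner space `L₁(μ; X)`; the proof works with
its simple functions, the tensors `∑ xₖ ⊗ hₖ` over finite disjoint positive families `h` in `Y`.

Two facts make these tensors behave like simple functions. By a spectral argument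
(`IsALSpace.exists_disjointFamily_approx`), finitely many positive elements of `Y` are nearly
combinations of one disjoint family, so such tensors are dense and any two of them can be compared
over a common family. Moreover `‖∑ xₖ ⊗ hₖ‖ = ∑ ‖xₖ‖ ‖hₖ‖` (`ProjTensor.norm_sumTmul`): the lower
bound pairs the tensor with a contractive bilinear form built from norming functionals of the `xₖ`
and band functionals of the `hₖ`.

The lattice structure comes from the modulus `∑ xₖ ⊗ hₖ ↦ ∑ |xₖ| ⊗ hₖ`, which is nonexpansive and
hence extends to `Z`. Positivity and solidity are checked coordinatewise and survive limits.

For LASQ₊, take a positive unit `y` almost square with respect to all `xₖ`, and normalise `∑ ‖xₖ‖ y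
⊗ hₖ`: adding or subtracting this tensor hardly increases any coordinate norm. For the diameter two
property, `y` is also made weakly small (`IsASQPlus.exists_abs_apply_le`) and the weights are raised
so that the perturbation has norm one. Up to scaling, `t ± z` then stay in the given weakly open set
and lie almost `2` apart. -/

theorem inf_add_le_inf_add_inf {G : Type*} [AddCommGroup G] [Lattice G] [IsOrderedAddMonoid G]
    {a b c : G} (ha : 0 ≤ a) (hb : 0 ≤ b) (hc : 0 ≤ c) : a ⊓ (b + c) ≤ a ⊓ b + a ⊓ c := by
  have h1 : a ⊓ (b + c) ≤ b + a ⊓ c := by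
    rw [add_inf]
    exact le_inf (inf_le_left.trans (le_add_of_nonneg_left hb)) inf_le_right
  rw [inf_add]
  exact le_inf (inf_le_left.trans (le_add_of_nonneg_right (le_inf ha hc))) h1

theorem inf_sum_le_sum_inf {G ι : Type*} [AddCommGroup G] [Lattice G] [IsOrderedAddMonoid G]
    {a : G} (ha : 0 ≤ a) {f : ι → G} (hf : ∀ i, 0 ≤ f i) (s : Finset ι) :
    a ⊓ ∑ i ∈ s, f i ≤ ∑ i ∈ s, a ⊓ f i := by
  classical
  induction s using Finset.induction_on with
  | empty => simp
  | insert i s hi ih =>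
    rw [Finset.sum_insert hi, Finset.sum_insert hi]
    exact (inf_add_le_inf_add_inf ha (hf i) (Finset.sum_nonneg fun j _ => hf j)).trans
      (add_le_add le_rfl ih)

theorem inf_eq_zero_mono {G : Type*} [AddCommGroup G] [Lattice G] {a b a' b' : G}
    (h : a ⊓ b = 0) (ha' : 0 ≤ a') (hb' : 0 ≤ b') (ha : a' ≤ a) (hb : b' ≤ b) : a' ⊓ b' = 0 :=
  le_antisymm ((inf_le_inf ha hb).trans h.le) (le_inf ha' hb')

theorem inf_nsmul_eq_zero {G : Type*} [AddCommGroup G] [Lattice G] [IsOrderedAddMonoid G]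
    {a b : G} (h : a ⊓ b = 0) (n : ℕ) : a ⊓ n • b = 0 := by
  have ha : 0 ≤ a := h ▸ inf_le_left
  have hb : 0 ≤ b := h ▸ inf_le_right
  induction n with
  | zero => simpa using ha
  | succ n ih =>
    refine le_antisymm ?_ (le_inf ha (nsmul_nonneg hb _))
    rw [succ_nsmul]
    refine (inf_add_le_inf_add_inf ha (nsmul_nonneg hb _) hb).trans ?_
    rw [ih, h, add_zero]

/-- A family of pairwise disjoint positive elements of a vector lattice. -/
structure IsDisjointFamily {ι Y : Type*} [AddCommGroup Y] [Lattice Y] (h : ι → Y) : Prop where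
  nonneg : ∀ i, 0 ≤ h i
  inf_eq_zero : ∀ i j, i ≠ j → h i ⊓ h j = 0

/-- Disjoint positive elements have their supremum as sum, because `a + b = a ⊓ b + a ⊔ b`. -/
theorem IsDisjointFamily.sum_le {ι G : Type*} [AddCommGroup G] [Lattice G] [IsOrderedAddMonoid G]
    {f : ι → G} (hf : IsDisjointFamily f) {y : G} (hy : 0 ≤ y) (hfy : ∀ i, f i ≤ y)
    (s : Finset ι) : ∑ i ∈ s, f i ≤ y := by
  classical
  induction s using Finset.induction_on with
  | empty => simpa using hy
  | insert i s hi ih =>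
    have h0 : f i ⊓ ∑ j ∈ s, f j = 0 := by
      refine le_antisymm ((inf_sum_le_sum_inf (hf.nonneg i) hf.nonneg s).trans ?_)
        (le_inf (hf.nonneg i) (Finset.sum_nonneg fun j _ => hf.nonneg j))
      refine (Finset.sum_eq_zero fun j hj => hf.inf_eq_zero i j ?_).le
      rintro rfl
      exact hi hj
    rw [Finset.sum_insert hi, ← inf_add_sup (f i), h0, zero_add]
    exact sup_le (hfy i) ih

theorem IsDisjointFamily.sum_inf_eq {ι G : Type*} [Fintype ι] [AddCommGroup G] [Lattice G]
    [IsOrderedAddMonoid G] {h : ι → G} (hh : IsDisjointFamily h) {y : G} (hy : 0 ≤ y)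
    (hyh : y ≤ ∑ i, h i) : ∑ i, y ⊓ h i = y := by
  refine le_antisymm (IsDisjointFamily.sum_le ⟨fun i => le_inf hy (hh.nonneg i), fun i j hij => ?_⟩
    hy (fun i => inf_le_left) _) ?_
  · exact inf_eq_zero_mono (hh.inf_eq_zero i j hij) (le_inf hy (hh.nonneg i))
      (le_inf hy (hh.nonneg j)) inf_le_right inf_le_right
  · calc y = y ⊓ ∑ i, h i := (inf_eq_left.2 hyh).symm
      _ ≤ _ := inf_sum_le_sum_inf hy hh.nonneg _

variable {Y : Type*} [NormedAddCommGroup Y] [NormedSpace ℝ Y] [Lattice Y] [IsBanachLattice Y]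

theorem norm_le_norm_of_nonneg_of_le {x y : Y} (hx : 0 ≤ x) (hxy : x ≤ y) : ‖x‖ ≤ ‖y‖ :=
  HasSolidNorm.solid (by rwa [abs_of_nonneg hx, abs_of_nonneg (hx.trans hxy)])

/-- In an AL-space the component of `u` in the band generated by `d` is `lim u ⊓ n d`. -/
theorem IsALSpace.exists_component (hY : IsALSpace Y) {u d : Y} (hu : 0 ≤ u) (hd : 0 ≤ d) :
    ∃ p : Y, Tendsto (fun n : ℕ => u ⊓ n • d) atTop (𝓝 p) ∧ 0 ≤ p ∧ p ≤ u ∧ (u - p) ⊓ d = 0 := by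
  set a : ℕ → Y := fun n => u ⊓ n • d with ha
  have hmono : Monotone a := fun m n hmn => inf_le_inf le_rfl (nsmul_le_nsmul_left hd hmn)
  have ha0 : ∀ n, 0 ≤ a n := fun n => le_inf hu (nsmul_nonneg hd n)
  have hau : ∀ n, a n ≤ u := fun n => inf_le_left
  -- Additivity of the norm turns distances along an increasing positive sequence into differences
  -- of norms, so bounded monotone norms force convergence.
  have hdist : ∀ m n, m ≤ n → dist (a n) (a m) = dist ‖a n‖ ‖a m‖ := by
    intro m n hmn
    have h := hY (a m) (a n - a m) (ha0 m) (sub_nonneg.2 (hmono hmn))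
    rw [add_sub_cancel] at h
    rw [dist_eq_norm, Real.dist_eq, h, add_sub_cancel_left, abs_norm]
  have hcn : CauchySeq fun n => ‖a n‖ := by
    refine (tendsto_atTop_ciSup (f := fun n => ‖a n‖) (fun m n hmn =>
      norm_le_norm_of_nonneg_of_le (ha0 m) (hmono hmn)) ⟨‖u‖, ?_⟩).cauchySeq
    rintro _ ⟨n, rfl⟩
    exact norm_le_norm_of_nonneg_of_le (ha0 n) (hau n)
  have hc : CauchySeq a := by
    rw [Metric.cauchySeq_iff'] at hcn ⊢
    intro ε hε
    obtain ⟨N, hN⟩ := hcn ε hε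
    exact ⟨N, fun n hn => (hdist N n hn).trans_lt (hN n hn)⟩
  obtain ⟨p, hp⟩ := cauchySeq_tendsto_of_complete hc
  refine ⟨p, hp, ge_of_tendsto' hp ha0, le_of_tendsto' hp hau, ?_⟩
  -- The part of `u - a n` below `d` is exactly the next increment, which tends to zero; hence the
  -- residue is disjoint from `d`.
  have hstep : ∀ n, (u - a n) ⊓ d = a (n + 1) - a n := by
    intro n
    rw [eq_sub_iff_add_eq, inf_add, sub_add_cancel, ha]
    simp only
    rw [add_inf, add_comm d (n • d), ← succ_nsmul, ← inf_assoc]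
    rw [inf_eq_left.2 (le_add_of_nonneg_left hd)]
  have h1 : Tendsto (fun n => (u - a n) ⊓ d) atTop (𝓝 ((u - p) ⊓ d)) :=
    (tendsto_const_nhds.sub hp).inf_nhds tendsto_const_nhds
  have h2 : Tendsto (fun n => (u - a n) ⊓ d) atTop (𝓝 0) := by
    simp only [hstep]
    simpa using (hp.comp (tendsto_add_atTop_nat 1)).sub hp
  exact tendsto_nhds_unique h1 h2

theorem inf_eq_zero_of_tendsto {u d p w : Y} (hp : Tendsto (fun n : ℕ => u ⊓ n • d) atTop (𝓝 p))
    (hu : 0 ≤ u) (h : w ⊓ d = 0) : w ⊓ p = 0 := by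
  have hw : 0 ≤ w := h ▸ inf_le_left
  have hd : 0 ≤ d := h ▸ inf_le_right
  have h1 : Tendsto (fun n : ℕ => w ⊓ (u ⊓ n • d)) atTop (𝓝 (w ⊓ p)) :=
    tendsto_const_nhds.inf_nhds hp
  have h2 : ∀ n : ℕ, w ⊓ (u ⊓ n • d) = 0 := fun n =>
    inf_eq_zero_mono (inf_nsmul_eq_zero h n) hw (le_inf hu (nsmul_nonneg hd n)) le_rfl inf_le_right
  simp only [h2] at h1
  exact tendsto_nhds_unique h1 tendsto_const_nhds

theorem le_smul_of_inf_eq_zero {d p q : Y} {t : ℝ} (ht : 0 ≤ t) (hd : 0 ≤ d) (hp : 0 ≤ p)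
    (hq : 0 ≤ q) (h : d ≤ t • (p + q)) (hdq : d ⊓ q = 0) : d ≤ t • p := by
  have h0 : d ⊓ t • q = 0 := by
    obtain ⟨n, hn⟩ := exists_nat_ge t
    refine inf_eq_zero_mono (inf_nsmul_eq_zero hdq n) hd (smul_nonneg ht hq) le_rfl ?_
    rw [← Nat.cast_smul_eq_nsmul ℝ]
    exact smul_le_smul_of_nonneg_right hn hq
  rw [smul_add] at h
  calc d = d ⊓ (t • p + t • q) := (inf_eq_left.2 h).symm
    _ ≤ d ⊓ t • p + d ⊓ t • q :=
      inf_add_le_inf_add_inf hd (smul_nonneg ht hp) (smul_nonneg ht hq)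
    _ ≤ t • p := by rw [h0, add_zero]; exact inf_le_right

/-- Think of `p` as the restriction of `g` to the set where `y > c g`: it is the component of `g` in
the band of `(y - c g)⁺`. The positive part of `y - c g` then lives on `p` and the negative part on
`q = g - p`. -/
theorem IsALSpace.exists_split (hY : IsALSpace Y) {g y : Y} (hg : 0 ≤ g) {a b c : ℝ} (hac : a ≤ c)
    (hcb : c ≤ b) (hay : a • g ≤ y) (hyb : y ≤ b • g) :
    ∃ p q y₁ y₂ : Y, 0 ≤ p ∧ 0 ≤ q ∧ p + q = g ∧ p ⊓ q = 0 ∧ y₁ + y₂ = y ∧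
      c • p ≤ y₁ ∧ y₁ ≤ b • p ∧ a • q ≤ y₂ ∧ y₂ ≤ c • q := by
  set d : Y := (y - c • g)⁺ with hd
  set d' : Y := (y - c • g)⁻ with hd'
  have hd0 : 0 ≤ d := posPart_nonneg _
  have hd0' : 0 ≤ d' := negPart_nonneg _
  have hdd : d ⊓ d' = 0 := posPart_inf_negPart_eq_zero _
  have hsub : d - d' = y - c • g := posPart_sub_negPart _
  obtain ⟨p, hp, hp0, hpg, hqd⟩ := hY.exists_component hg hd0
  have hpd : d' ⊓ p = 0 := inf_eq_zero_of_tendsto hp hg (by rw [inf_comm, hdd])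
  have hqp : (g - p) ⊓ p = 0 := inf_eq_zero_of_tendsto hp hg hqd
  have hq0 : 0 ≤ g - p := sub_nonneg.2 hpg
  have h1 : d ≤ (b - c) • p := by
    refine le_smul_of_inf_eq_zero (sub_nonneg.2 hcb) hd0 hp0 hq0 ?_ (by rw [inf_comm, hqd])
    rw [add_sub_cancel, sub_smul]
    refine sup_le (sub_le_sub_right hyb _) ?_
    rw [← sub_smul]
    exact smul_nonneg (sub_nonneg.2 hcb) hg
  have h2 : d' ≤ (c - a) • (g - p) := by
    refine le_smul_of_inf_eq_zero (sub_nonneg.2 hac) hd0' hq0 hp0 ?_ hpd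
    rw [sub_add_cancel, sub_smul]
    refine sup_le ?_ ?_
    · rw [neg_sub]
      exact sub_le_sub_left hay _
    · rw [← sub_smul]
      exact smul_nonneg (sub_nonneg.2 hac) hg
  refine ⟨p, g - p, c • p + d, c • (g - p) - d', hp0, hq0, by abel, by rw [inf_comm, hqp],
    ?_, le_add_of_nonneg_right hd0, ?_, ?_, sub_le_self _ hd0'⟩
  · have : c • p + d + (c • (g - p) - d') = c • g + (d - d') := by rw [smul_sub]; abel
    rw [this, hsub]; abel
  · calc c • p + d ≤ c • p + (b - c) • p := by gcongr
      _ = b • p := by rw [← add_smul]; congr 1; ring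
  · calc a • (g - p) = c • (g - p) - (c - a) • (g - p) := by rw [← sub_smul]; congr 1; ring
      _ ≤ _ := by gcongr

/-- Freudenthal's spectral theorem, by repeated bisection. -/
theorem IsALSpace.exists_partition (hY : IsALSpace Y) (n : ℕ) :
    ∀ {g y : Y} {a b : ℝ}, 0 ≤ g → a ≤ b → a • g ≤ y → y ≤ b • g →
    ∃ (κ : Type) (_ : Fintype κ) (h : κ → Y) (c : κ → ℝ), IsDisjointFamily h ∧ ∑ k, h k = g ∧
      (∀ k, a ≤ c k) ∧ ∑ k, c k • h k ≤ y ∧ y ≤ ∑ k, c k • h k + ((b - a) / 2 ^ n) • g := by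
  induction n with
  | zero =>
    intro g y a b hg _ hay hyb
    refine ⟨Unit, inferInstance, fun _ => g, fun _ => a, ⟨fun _ => hg, fun i j hij => ?_⟩,
      by simp, fun _ => le_rfl, by simpa using hay, ?_⟩
    · exact absurd (Subsingleton.elim i j) hij
    · simpa [← add_smul] using hyb
  | succ n ih =>
    intro g y a b hg hab hay hyb
    obtain ⟨p, q, y₁, y₂, hp, hq, hpq, hinf, hy, h1, h2, h3, h4⟩ :=
      hY.exists_split (c := (a + b) / 2) hg (by linarith) (by linarith) hay hyb
    obtain ⟨κ, _, h, c, hh, hs, hc, hl, hu⟩ := ih hp (by linarith) h1 h2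
    obtain ⟨κ', _, h', c', hh', hs', hc', hl', hu'⟩ := ih hq (by linarith) h3 h4
    have hle : ∀ k, h k ≤ p := fun k => hs ▸
      Finset.single_le_sum (fun i _ => hh.nonneg i) (Finset.mem_univ k)
    have hle' : ∀ k, h' k ≤ q := fun k => hs' ▸
      Finset.single_le_sum (fun i _ => hh'.nonneg i) (Finset.mem_univ k)
    refine ⟨κ ⊕ κ', inferInstance, Sum.elim h h', Sum.elim c c', ⟨?_, ?_⟩, ?_, ?_, ?_, ?_⟩
    · rintro (k | k)
      exacts [hh.nonneg k, hh'.nonneg k]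
    · rintro (k | k) (l | l) hkl
      · exact hh.inf_eq_zero k l (by simpa using hkl)
      · exact inf_eq_zero_mono hinf (hh.nonneg k) (hh'.nonneg l) (hle k) (hle' l)
      · rw [inf_comm]
        exact inf_eq_zero_mono hinf (hh.nonneg l) (hh'.nonneg k) (hle l) (hle' k)
      · exact hh'.inf_eq_zero k l (by simpa using hkl)
    · simp [hs, hs', hpq]
    · rintro (k | k)
      · exact le_trans (by linarith) (hc k)
      · exact hc' k
    · simp only [Fintype.sum_sum_type, Sum.elim_inl, Sum.elim_inr]
      exact hy ▸ add_le_add hl hl'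
    · simp only [Fintype.sum_sum_type, Sum.elim_inl, Sum.elim_inr]
      have e1 : (b - (a + b) / 2) / 2 ^ n = (b - a) / 2 ^ (n + 1) := by field_simp; ring
      have e2 : ((a + b) / 2 - a) / 2 ^ n = (b - a) / 2 ^ (n + 1) := by field_simp; ring
      rw [e1] at hu
      rw [e2] at hu'
      rw [← hy, ← hpq, smul_add, add_add_add_comm]
      exact add_le_add hu hu'

/-- When an element `y j` is added, each cell `h k` is subdivided by the spectral approximation of
`y j ⊓ h k`, which lies between `0` and `h k`. The earlier coefficients are constant on the old
cells, so they and their estimates carry over to the refinement. -/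
theorem IsALSpace.exists_common_partition (hY : IsALSpace Y) {ι : Type*} {y : ι → Y} {E : Y}
    (hE : 0 ≤ E) (hy : ∀ i, 0 ≤ y i) (hyE : ∀ i, y i ≤ E) (n : ℕ) (s : Finset ι) :
    ∃ (κ : Type) (_ : Fintype κ) (h : κ → Y) (a : ι → κ → ℝ), IsDisjointFamily h ∧
      ∑ k, h k = E ∧ (∀ i k, 0 ≤ a i k) ∧
      ∀ i ∈ s, ∑ k, a i k • h k ≤ y i ∧ y i ≤ ∑ k, a i k • h k + ((1 : ℝ) / 2 ^ n) • E := by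
  classical
  induction s using Finset.induction_on with
  | empty =>
    refine ⟨Unit, inferInstance, fun _ => E, fun _ _ => 0, ⟨fun _ => hE, fun i j hij => ?_⟩,
      by simp, fun _ _ => le_rfl, by simp⟩
    exact absurd (Subsingleton.elim i j) hij
  | insert j s hj ih =>
    obtain ⟨κ, _, h, a, hh, hs, ha, hay⟩ := ih
    have key := fun k => hY.exists_partition n (g := h k) (y := y j ⊓ h k) (a := 0) (b := 1)
      (hh.nonneg k) zero_le_one (by simpa using ⟨hy j, hh.nonneg k⟩)
      (by rw [one_smul]; exact inf_le_right)
    choose κ' _ h' c' hh' hs' hc' hl' hu' using key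
    have hle : ∀ k l, h' k l ≤ h k := fun k l => by
      conv_rhs => rw [← hs' k]
      exact Finset.single_le_sum (fun i _ => (hh' k).nonneg i) (Finset.mem_univ l)
    have hyj : ∑ k, y j ⊓ h k = y j := hh.sum_inf_eq (hy j) (by rw [hs]; exact hyE j)
    refine ⟨Σ k, κ' k, inferInstance, fun m => h' m.1 m.2,
      fun i m => if i = j then c' m.1 m.2 else a i m.1, ⟨fun m => (hh' m.1).nonneg m.2, ?_⟩,
      ?_, ?_, ?_⟩
    · rintro ⟨k, l⟩ ⟨k', l'⟩ hne
      by_cases hk : k = k'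
      · subst hk
        exact (hh' k).inf_eq_zero l l' (by rintro rfl; exact hne rfl)
      · exact inf_eq_zero_mono (hh.inf_eq_zero k k' hk) ((hh' k).nonneg l) ((hh' k').nonneg l')
          (hle k l) (hle k' l')
    · simp only [Fintype.sum_sigma, hs', hs]
    · rintro i ⟨k, l⟩
      dsimp only
      split_ifs
      exacts [hc' k l, ha i k]
    · intro i hi
      by_cases hij : i = j
      · subst hij
        simp only [if_true, Fintype.sum_sigma]
        constructor
        · calc _ ≤ ∑ k, y i ⊓ h k := Finset.sum_le_sum fun k _ => hl' k
            _ = y i := hyj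
        · calc y i = ∑ k, y i ⊓ h k := hyj.symm
            _ ≤ ∑ k, (∑ l, c' k l • h' k l + ((1 - 0 : ℝ) / 2 ^ n) • h k) :=
              Finset.sum_le_sum fun k _ => hu' k
            _ = _ := by rw [Finset.sum_add_distrib, ← Finset.smul_sum, hs, sub_zero]
      · simp only [if_neg hij, Fintype.sum_sigma, ← Finset.smul_sum, hs']
        exact hay i (Finset.mem_of_mem_insert_of_ne hi hij)

/-- Finitely many positive elements of an AL-space are approximated from below by positive
combinations of one finite disjoint family. -/
theorem IsALSpace.exists_disjointFamily_approx (hY : IsALSpace Y) {ι : Type*} [Fintype ι]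
    {y : ι → Y} (hy : ∀ i, 0 ≤ y i) {ε : ℝ} (hε : 0 < ε) :
    ∃ (κ : Type) (_ : Fintype κ) (h : κ → Y) (a : ι → κ → ℝ), IsDisjointFamily h ∧
      (∀ i k, 0 ≤ a i k) ∧
      ∀ i, ∑ k, a i k • h k ≤ y i ∧ ‖y i - ∑ k, a i k • h k‖ ≤ ε := by
  set E : Y := ∑ i, y i with hE
  obtain ⟨n, hn⟩ : ∃ n : ℕ, (1 : ℝ) / 2 ^ n * ‖E‖ ≤ ε := by
    have h : Tendsto (fun n : ℕ => (1 : ℝ) / 2 ^ n * ‖E‖) atTop (𝓝 0) := by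
      have := (tendsto_pow_atTop_nhds_zero_of_lt_one (r := (1 / 2 : ℝ)) (by norm_num)
        (by norm_num)).mul_const ‖E‖
      simpa [one_div] using this
    exact ((h.eventually (gt_mem_nhds hε)).exists).imp fun _ => le_of_lt
  obtain ⟨κ, _, h, a, hh, -, ha, hay⟩ := hY.exists_common_partition (E := E)
    (Finset.sum_nonneg fun i _ => hy i) hy
    (fun i => Finset.single_le_sum (fun i _ => hy i) (Finset.mem_univ i)) n Finset.univ
  refine ⟨κ, inferInstance, h, a, hh, ha, fun i => ?_⟩
  obtain ⟨h1, h2⟩ := hay i (Finset.mem_univ i)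
  refine ⟨h1, (norm_le_norm_of_nonneg_of_le (sub_nonneg.2 h1) (sub_le_iff_le_add'.2 h2)).trans ?_⟩
  rw [norm_smul, Real.norm_of_nonneg (by positivity)]
  exact hn

end ALSpace

/-! ### Band components and the functionals they define. -/

section BandFunctional

open Filter Topology

variable {Y : Type*} [NormedAddCommGroup Y] [NormedSpace ℝ Y] [Lattice Y] [IsBanachLattice Y]

theorem IsALSpace.norm_posPart_add_norm_negPart (hY : IsALSpace Y) (y : Y) :
    ‖y⁺‖ + ‖y⁻‖ = ‖y‖ := by
  rw [← hY _ _ (posPart_nonneg y) (negPart_nonneg y), posPart_add_negPart]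
  exact norm_abs_eq_norm y

/-- The component of `u` in the band generated by `d`, for `u, d ≥ 0` in an AL-space. -/
def bandComponent (d u : Y) : Y := limUnder atTop fun n : ℕ => u ⊓ n • d

theorem IsALSpace.tendsto_bandComponent (hY : IsALSpace Y) {u d : Y} (hu : 0 ≤ u) (hd : 0 ≤ d) :
    Tendsto (fun n : ℕ => u ⊓ n • d) atTop (𝓝 (bandComponent d u)) := by
  obtain ⟨p, hp, -⟩ := hY.exists_component hu hd
  exact tendsto_nhds_limUnder ⟨p, hp⟩

theorem IsALSpace.bandComponent_nonneg (hY : IsALSpace Y) {u d : Y} (hu : 0 ≤ u) (hd : 0 ≤ d) :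
    0 ≤ bandComponent d u :=
  ge_of_tendsto' (hY.tendsto_bandComponent hu hd) fun _ => le_inf hu (nsmul_nonneg hd _)

theorem IsALSpace.bandComponent_le (hY : IsALSpace Y) {u d : Y} (hu : 0 ≤ u) (hd : 0 ≤ d) :
    bandComponent d u ≤ u :=
  le_of_tendsto' (hY.tendsto_bandComponent hu hd) fun _ => inf_le_left

theorem IsALSpace.bandComponent_self (hY : IsALSpace Y) {d : Y} (hd : 0 ≤ d) :
    bandComponent d d = d := by
  refine tendsto_nhds_unique (hY.tendsto_bandComponent hd hd) ?_
  refine tendsto_const_nhds.congr' ((eventually_ge_atTop 1).mono fun n hn => ?_)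
  refine (inf_eq_left.2 ?_).symm
  simpa using nsmul_le_nsmul_left hd hn

theorem IsALSpace.bandComponent_of_inf_eq_zero (hY : IsALSpace Y) {u d : Y} (h : u ⊓ d = 0) :
    bandComponent d u = 0 := by
  have hu : 0 ≤ u := h ▸ inf_le_left
  have hd : 0 ≤ d := h ▸ inf_le_right
  refine tendsto_nhds_unique (hY.tendsto_bandComponent hu hd) ?_
  simp [inf_nsmul_eq_zero h]

/-- One inequality is subadditivity of truncation; the other compares `u ⊓ n d + v ⊓ n d` with `(u +
v) ⊓ 2n d`, whence the passage to even indices. -/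
theorem IsALSpace.bandComponent_add (hY : IsALSpace Y) {u v d : Y} (hu : 0 ≤ u) (hv : 0 ≤ v)
    (hd : 0 ≤ d) : bandComponent d (u + v) = bandComponent d u + bandComponent d v := by
  have h1 := hY.tendsto_bandComponent (add_nonneg hu hv) hd
  have h2 := (hY.tendsto_bandComponent hu hd).add (hY.tendsto_bandComponent hv hd)
  have h3 := h1.comp (tendsto_id.const_mul_atTop' (r := 2) (by norm_num))
  refine le_antisymm (le_of_tendsto_of_tendsto' h1 h2 fun n => ?_)
    (le_of_tendsto_of_tendsto' h2 h3 fun n => ?_)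
  · rw [inf_comm, inf_comm u, inf_comm v]
    exact inf_add_le_inf_add_inf (nsmul_nonneg hd n) hu hv
  · simp only [Function.comp_apply, id]
    refine le_inf (add_le_add inf_le_left inf_le_left) ?_
    rw [two_mul, add_nsmul]
    exact add_le_add inf_le_right inf_le_right

theorem IsALSpace.sum_bandComponent_le (hY : IsALSpace Y) {κ : Type*} [Fintype κ] {h : κ → Y}
    (hh : IsDisjointFamily h) {u : Y} (hu : 0 ≤ u) : ∑ k, bandComponent (h k) u ≤ u := by
  refine IsDisjointFamily.sum_le ⟨fun k => hY.bandComponent_nonneg hu (hh.nonneg k),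
    fun i j hij => ?_⟩ hu (fun k => hY.bandComponent_le hu (hh.nonneg k)) _
  refine inf_eq_zero_of_tendsto (hY.tendsto_bandComponent hu (hh.nonneg j)) hu ?_
  rw [inf_comm]
  refine inf_eq_zero_of_tendsto (hY.tendsto_bandComponent hu (hh.nonneg i)) hu ?_
  exact hh.inf_eq_zero j i hij.symm

theorem IsALSpace.norm_sum (hY : IsALSpace Y) {κ : Type*} {f : κ → Y} (hf : ∀ k, 0 ≤ f k)
    (s : Finset κ) : ‖∑ k ∈ s, f k‖ = ∑ k ∈ s, ‖f k‖ := by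
  classical
  induction s using Finset.induction_on with
  | empty => simp
  | insert i s hi ih =>
    rw [Finset.sum_insert hi, Finset.sum_insert hi, hY _ _ (hf i)
      (Finset.sum_nonneg fun j _ => hf j), ih]

theorem IsALSpace.sum_norm_bandComponent_le (hY : IsALSpace Y) {κ : Type*} [Fintype κ] {h : κ → Y}
    (hh : IsDisjointFamily h) {u : Y} (hu : 0 ≤ u) : ∑ k, ‖bandComponent (h k) u‖ ≤ ‖u‖ := by
  have h0 := fun k => hY.bandComponent_nonneg hu (hh.nonneg k)
  rw [← hY.norm_sum h0]
  exact norm_le_norm_of_nonneg_of_le (Finset.sum_nonneg fun k _ => h0 k)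
    (hY.sum_bandComponent_le hh hu)

/-- The functional `y ↦ ‖P y⁺‖ - ‖P y⁻‖`, where `P` is the band projection given by `d`. -/
def IsALSpace.bandFunctional (hY : IsALSpace Y) {d : Y} (hd : 0 ≤ d) : Y →L[ℝ] ℝ :=
  AddMonoidHom.toRealLinearMap
    (AddMonoidHom.mk' (fun y => ‖bandComponent d y⁺‖ - ‖bandComponent d y⁻‖) fun a b => by
      have key : ∀ {u v : Y}, 0 ≤ u → 0 ≤ v →
          ‖bandComponent d (u + v)‖ = ‖bandComponent d u‖ + ‖bandComponent d v‖ := fun hu hv => by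
        rw [hY.bandComponent_add hu hv hd,
          hY _ _ (hY.bandComponent_nonneg hu hd) (hY.bandComponent_nonneg hv hd)]
      -- Additivity is known only on the cone, so the identity for positive and negative parts is
      -- first rearranged into an equality of positive sums.
      have e : (a + b)⁺ + (a⁻ + b⁻) = (a + b)⁻ + (a⁺ + b⁺) := by
        have h1 := posPart_sub_negPart (a + b)
        have h2 := posPart_sub_negPart a
        have h3 := posPart_sub_negPart b
        have : (a + b)⁺ - (a + b)⁻ = (a⁺ - a⁻) + (b⁺ - b⁻) := by rw [h1, h2, h3]
        rw [sub_eq_iff_eq_add] at this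
        rw [this]
        abel
      have e' := congrArg (fun u => ‖bandComponent d u‖) e
      rw [key (posPart_nonneg _) (add_nonneg (negPart_nonneg _) (negPart_nonneg _)),
        key (negPart_nonneg _) (negPart_nonneg _),
        key (negPart_nonneg _) (add_nonneg (posPart_nonneg _) (posPart_nonneg _)),
        key (posPart_nonneg _) (posPart_nonneg _)] at e'
      linarith)
    (by
      refine AddMonoidHomClass.continuous_of_bound _ 1 fun y => ?_
      rw [one_mul, ← hY.norm_posPart_add_norm_negPart y, Real.norm_eq_abs]
      have h1 := norm_le_norm_of_nonneg_of_le (hY.bandComponent_nonneg (posPart_nonneg y) hd)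
        (hY.bandComponent_le (posPart_nonneg y) hd)
      have h2 := norm_le_norm_of_nonneg_of_le (hY.bandComponent_nonneg (negPart_nonneg y) hd)
        (hY.bandComponent_le (negPart_nonneg y) hd)
      refine (abs_sub _ _).trans ?_
      rw [abs_norm, abs_norm]
      exact add_le_add h1 h2)

theorem IsALSpace.bandFunctional_apply (hY : IsALSpace Y) {d : Y} (hd : 0 ≤ d) (y : Y) :
    hY.bandFunctional hd y = ‖bandComponent d y⁺‖ - ‖bandComponent d y⁻‖ := rfl

theorem IsALSpace.bandFunctional_self (hY : IsALSpace Y) {d : Y} (hd : 0 ≤ d) :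
    hY.bandFunctional hd d = ‖d‖ := by
  rw [hY.bandFunctional_apply, posPart_of_nonneg hd, negPart_of_nonneg hd,
    hY.bandComponent_self hd, hY.bandComponent_of_inf_eq_zero (inf_eq_left.2 hd)]
  simp

theorem IsALSpace.bandFunctional_of_inf_eq_zero (hY : IsALSpace Y) {d y : Y} (hd : 0 ≤ d)
    (h : y ⊓ d = 0) : hY.bandFunctional hd y = 0 := by
  have hy : 0 ≤ y := h ▸ inf_le_left
  rw [hY.bandFunctional_apply, posPart_of_nonneg hy, negPart_of_nonneg hy,
    hY.bandComponent_of_inf_eq_zero h, hY.bandComponent_of_inf_eq_zero (inf_eq_left.2 hd)]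
  simp

/-- Disjoint bands share the mass of `y` without overlap. This is what makes the bilinear form in
the proof of `norm_sumTmul` contractive. -/
theorem IsALSpace.sum_abs_bandFunctional_le (hY : IsALSpace Y) {κ : Type*} [Fintype κ] {h : κ → Y}
    (hh : IsDisjointFamily h) (y : Y) : ∑ k, |hY.bandFunctional (hh.nonneg k) y| ≤ ‖y‖ := by
  rw [← hY.norm_posPart_add_norm_negPart y]
  calc _ ≤ ∑ k, (‖bandComponent (h k) y⁺‖ + ‖bandComponent (h k) y⁻‖) := by
        refine Finset.sum_le_sum fun k _ => ?_
        rw [hY.bandFunctional_apply]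
        refine (abs_sub _ _).trans ?_
        rw [abs_norm, abs_norm]
    _ ≤ _ := by
        rw [Finset.sum_add_distrib]
        exact add_le_add (hY.sum_norm_bandComponent_le hh (posPart_nonneg y))
          (hY.sum_norm_bandComponent_le hh (negPart_nonneg y))

end BandFunctional

namespace ProjTensor

/-! ### Finite tensors and the projective norm. -/

section Basic

variable {X Y : Type*} [NormedAddCommGroup X] [NormedSpace ℝ X]
  [NormedAddCommGroup Y] [NormedSpace ℝ Y]

theorem add_tmul (x x' : X) (y : Y) : tmul (x + x') y = tmul x y + tmul x' y := by
  simp [tmul, TensorProduct.add_tmul]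

theorem tmul_add (x : X) (y y' : Y) : tmul x (y + y') = tmul x y + tmul x y' := by
  simp [tmul, TensorProduct.tmul_add]

theorem smul_tmul' (r : ℝ) (x : X) (y : Y) : tmul (r • x) y = r • tmul x y := by
  simp [tmul, ← TensorProduct.smul_tmul']

theorem tmul_smul (r : ℝ) (x : X) (y : Y) : tmul x (r • y) = r • tmul x y := by
  simp [tmul]

variable (X Y) in
/-- The canonical bilinear map. -/
def mk : X →ₗ[ℝ] Y →ₗ[ℝ] ProjTensor X Y :=
  LinearMap.mk₂ ℝ tmul add_tmul smul_tmul' tmul_add tmul_smul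

@[simp]
theorem mk_apply (x : X) (y : Y) : mk X Y x y = tmul x y := rfl

theorem norm_tmul_le (x : X) (y : Y) : ‖tmul x y‖ ≤ ‖x‖ * ‖y‖ := by
  rw [tmul, LinearIsometry.norm_map, AlgProjTensor.norm_of]
  exact csInf_le (projectiveCosts_bddBelow _) ⟨[(x, y)], by simp, by simp⟩

/-- The tensor `∑ xᵢ ⊗ yᵢ` of two finite families. -/
def sumTmul {ι : Type*} [Fintype ι] (y : ι → Y) (x : ι → X) : ProjTensor X Y :=
  ∑ i, tmul (x i) (y i)

variable {ι κ : Type*} [Fintype ι] [Fintype κ]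

theorem sumTmul_add (y : ι → Y) (x x' : ι → X) :
    sumTmul y (x + x') = sumTmul y x + sumTmul y x' := by
  simp [sumTmul, add_tmul, Finset.sum_add_distrib]

theorem sumTmul_smul (y : ι → Y) (r : ℝ) (x : ι → X) :
    sumTmul y (r • x) = r • sumTmul y x := by
  simp [sumTmul, smul_tmul', Finset.smul_sum]

theorem sumTmul_neg (y : ι → Y) (x : ι → X) : sumTmul y (-x) = -sumTmul y x := by
  simpa using sumTmul_smul y (-1) x

theorem sumTmul_sub (y : ι → Y) (x x' : ι → X) :
    sumTmul y (x - x') = sumTmul y x - sumTmul y x' := by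
  rw [sub_eq_add_neg, sumTmul_add, sumTmul_neg, sub_eq_add_neg]

theorem sumTmul_sumElim (y : ι → Y) (y' : κ → Y) (x : ι → X) (x' : κ → X) :
    sumTmul (Sum.elim y y') (Sum.elim x x') = sumTmul y x + sumTmul y' x' := by
  simp [sumTmul]

theorem sumTmul_zero (y : ι → Y) : sumTmul y (0 : ι → X) = 0 := by
  simpa using sumTmul_smul y 0 (0 : ι → X)

theorem norm_sumTmul_le (y : ι → Y) (x : ι → X) : ‖sumTmul y x‖ ≤ ∑ i, ‖x i‖ * ‖y i‖ :=
  (norm_sum_le _ _).trans (Finset.sum_le_sum fun _ _ => norm_tmul_le _ _)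

/-- Almost squareness is applied in each coordinate, where the maximum is `r k`. The weights may
exceed `‖x k‖`, a freedom that the diameter two property needs. -/
theorem norm_sumTmul_add_smul_le {h : κ → Y} {x : κ → X} {y : X} {ε : ℝ}
    (hy : ∀ i (r : ℝ), ‖x i + r • y‖ ≤ (1 + ε) * max ‖x i‖ |r|) {r s : κ → ℝ}
    (hs : ∀ k, |s k| = r k) (hr : ∀ k, ‖x k‖ ≤ r k) :
    ‖sumTmul h x + sumTmul h fun k => s k • y‖ ≤ (1 + ε) * ∑ k, r k * ‖h k‖ := by
  rw [← sumTmul_add]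
  refine (norm_sumTmul_le _ _).trans ?_
  rw [Finset.mul_sum]
  refine Finset.sum_le_sum fun k _ => ?_
  rw [← mul_assoc]
  refine mul_le_mul_of_nonneg_right ((hy k (s k)).trans_eq ?_) (norm_nonneg _)
  rw [hs, max_eq_right (hr k)]

/-- A contractive bilinear form is bounded by the projective norm. -/
theorem sum_bilin_le_norm_sumTmul (B : X →ₗ[ℝ] Y →ₗ[ℝ] ℝ) (hB : ∀ x y, B x y ≤ ‖x‖ * ‖y‖)
    (y : ι → Y) (x : ι → X) : ∑ i, B (x i) (y i) ≤ ‖sumTmul y x‖ := by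
  have e : sumTmul y x = ofAlg X Y (AlgProjTensor.of X Y (∑ i, x i ⊗ₜ[ℝ] y i)) := by
    simp [sumTmul, tmul]
  have e' : ∑ i, B (x i) (y i) = TensorProduct.lift B (∑ i, x i ⊗ₜ[ℝ] y i) := by simp
  rw [e, e', LinearIsometry.norm_map, AlgProjTensor.norm_of]
  refine le_csInf (projectiveCosts_nonempty _) ?_
  rintro r ⟨l, hl, rfl⟩
  rw [← hl, map_list_sum, List.map_map]
  refine List.sum_le_sum fun p _ => ?_
  simpa using hB p.1 p.2

theorem exists_alg_norm_sub_lt (z : ProjTensor X Y) {ε : ℝ} (hε : 0 < ε) :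
    ∃ u : X ⊗[ℝ] Y, ‖z - ofAlg X Y (AlgProjTensor.of X Y u)‖ < ε := by
  have h : DenseRange (ofAlg X Y) :=
    UniformSpace.Completion.denseRange_coe (α := AlgProjTensor X Y)
  obtain ⟨u, hu⟩ := h.exists_dist_lt z hε
  exact ⟨(AlgProjTensor.of X Y).symm u, by simpa [dist_eq_norm] using hu⟩

/-- Push the coefficients of a family along a matrix. -/
def matAct {ι κ : Type*} [Fintype ι] (a : ι → κ → ℝ) (x : ι → X) : κ → X :=
  fun k => ∑ i, a i k • x i

theorem sumTmul_matAct {ι κ : Type*} [Fintype ι] [Fintype κ] (a : ι → κ → ℝ) (h : κ → Y)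
    (x : ι → X) : sumTmul h (matAct a x) = sumTmul (fun i => ∑ k, a i k • h k) x := by
  simp only [sumTmul, matAct, ← mk_apply, map_sum, LinearMap.sum_apply, map_smul,
    LinearMap.smul_apply]
  exact Finset.sum_comm

theorem norm_sumTmul_sub_le {ι κ : Type*} [Fintype ι] [Fintype κ] {a : ι → κ → ℝ} {h : κ → Y}
    {y : ι → Y} {ε : ℝ} (hε : ∀ i, ‖y i - ∑ k, a i k • h k‖ ≤ ε) (x : ι → X) :
    ‖sumTmul y x - sumTmul h (matAct a x)‖ ≤ ε * ∑ i, ‖x i‖ := by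
  have e : sumTmul y x - sumTmul h (matAct a x) =
      sumTmul (fun i => y i - ∑ k, a i k • h k) x := by
    rw [sumTmul_matAct]
    simp only [sumTmul, ← mk_apply, map_sub, Finset.sum_sub_distrib]
  rw [e, Finset.mul_sum]
  refine (norm_sumTmul_le _ _).trans (Finset.sum_le_sum fun i _ => ?_)
  rw [mul_comm]
  exact mul_le_mul_of_nonneg_right (hε i) (norm_nonneg _)

theorem sumTmul_congr_of_ne_zero {κ : Type*} [Fintype κ] {h : κ → Y} {x x' : κ → X}
    (hx : ∀ k, h k ≠ 0 → x k = x' k) : sumTmul h x = sumTmul h x' := by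
  refine Finset.sum_congr rfl fun k _ => ?_
  by_cases hk : h k = 0
  · simp [hk, ← mk_apply]
  · rw [hx k hk]

end Basic

/-! ### Density of tensors over disjoint families, and their norm. -/

section Lattice

variable {X Y : Type*} [NormedAddCommGroup X] [NormedSpace ℝ X]
  [NormedAddCommGroup Y] [NormedSpace ℝ Y] [Lattice Y] [IsBanachLattice Y]

/-- Each second factor is split into positive and negative parts, and the sign is moved to the first
factor. -/
theorem exists_sumTmul_eq (u : X ⊗[ℝ] Y) :
    ∃ (ι : Type) (_ : Fintype ι) (y : ι → Y) (x : ι → X), (∀ i, 0 ≤ y i) ∧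
      ofAlg X Y (AlgProjTensor.of X Y u) = sumTmul y x := by
  induction u using TensorProduct.induction_on with
  | zero => exact ⟨Empty, inferInstance, Empty.elim, Empty.elim, by simp, by simp [sumTmul]⟩
  | tmul x y =>
    refine ⟨Unit ⊕ Unit, inferInstance, Sum.elim (fun _ => y⁺) (fun _ => y⁻),
      Sum.elim (fun _ => x) (fun _ => -x), ?_, ?_⟩
    · rintro (_ | _)
      exacts [posPart_nonneg y, negPart_nonneg y]
    · have h : tmul (-x) y⁻ = -tmul x y⁻ := by simpa using smul_tmul' (-1) x y⁻
      have h' : tmul x (-y⁻) = -tmul x y⁻ := by simpa using tmul_smul (-1) x y⁻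
      change tmul x y = _
      rw [sumTmul_sumElim]
      simp only [sumTmul, Finset.univ_unique, Finset.sum_singleton]
      rw [h, ← h', ← tmul_add, ← sub_eq_add_neg, posPart_sub_negPart]
  | add u v hu hv =>
    obtain ⟨ι, _, y, x, hy, hu⟩ := hu
    obtain ⟨κ, _, y', x', hy', hv⟩ := hv
    refine ⟨ι ⊕ κ, inferInstance, Sum.elim y y', Sum.elim x x', ?_, ?_⟩
    · rintro (i | i)
      exacts [hy i, hy' i]
    · rw [sumTmul_sumElim, map_add, map_add, hu, hv]

theorem exists_norm_sub_sumTmul_lt (z : ProjTensor X Y) {ε : ℝ} (hε : 0 < ε) :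
    ∃ (ι : Type) (_ : Fintype ι) (y : ι → Y) (x : ι → X), (∀ i, 0 ≤ y i) ∧
      ‖z - sumTmul y x‖ < ε := by
  obtain ⟨u, hu⟩ := exists_alg_norm_sub_lt z hε
  obtain ⟨ι, _, y, x, hy, e⟩ := exists_sumTmul_eq u
  exact ⟨ι, inferInstance, y, x, hy, e ▸ hu⟩

/-- The norm is additive over disjoint families. -/
theorem norm_sumTmul (hY : IsALSpace Y) {κ : Type*} [Fintype κ] {h : κ → Y}
    (hh : IsDisjointFamily h) (x : κ → X) : ‖sumTmul h x‖ = ∑ k, ‖x k‖ * ‖h k‖ := by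
  classical
  refine le_antisymm (norm_sumTmul_le _ _) ?_
  choose f hf hfx using fun k => exists_dual_vector'' ℝ (x k)
  set φ := fun k => hY.bandFunctional (hh.nonneg k) with hφ
  -- On `(x l, h l)` only the `l`-th summand survives, by disjointness, and it equals `‖x l‖ ‖h l‖`.
  set B : X →ₗ[ℝ] Y →ₗ[ℝ] ℝ := ∑ k, (f k : X →ₗ[ℝ] ℝ).smulRight (φ k : Y →ₗ[ℝ] ℝ) with hB
  have hBa : ∀ x y, B x y = ∑ k, f k x * φ k y := fun x y => by simp [hB, LinearMap.sum_apply]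
  have hφh : ∀ k l, φ k (h l) = if k = l then ‖h l‖ else 0 := fun k l => by
    split_ifs with hkl
    · subst hkl
      exact hY.bandFunctional_self _
    · exact hY.bandFunctional_of_inf_eq_zero _ (hh.inf_eq_zero l k (Ne.symm hkl))
  refine le_trans (le_of_eq ?_) (sum_bilin_le_norm_sumTmul B (fun x y => ?_) h x)
  · refine Finset.sum_congr rfl fun k _ => ?_
    rw [hBa]
    simp only [hφh]
    simp [hfx]
  · rw [hBa]
    calc _ ≤ ∑ k, ‖x‖ * |φ k y| := Finset.sum_le_sum fun k _ => by
          refine (le_abs_self _).trans ?_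
          rw [abs_mul]
          refine mul_le_mul_of_nonneg_right ?_ (abs_nonneg _)
          exact ((f k).le_opNorm x).trans (mul_le_of_le_one_left (norm_nonneg _) (hf k))
      _ ≤ _ := by
          rw [← Finset.mul_sum]
          exact mul_le_mul_of_nonneg_left (hY.sum_abs_bandFunctional_le hh y) (norm_nonneg _)

theorem norm_sumTmul_smul_const (hY : IsALSpace Y) {κ : Type*} [Fintype κ] {h : κ → Y}
    (hh : IsDisjointFamily h) {r : κ → ℝ} (hr : ∀ k, 0 ≤ r k) {y : X} (hy : ‖y‖ = 1) :
    ‖sumTmul h fun k => r k • y‖ = ∑ k, r k * ‖h k‖ := by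
  rw [norm_sumTmul hY hh]
  refine Finset.sum_congr rfl fun k _ => ?_
  rw [norm_smul, hy, mul_one, Real.norm_of_nonneg (hr k)]

/-- Tensors over disjoint families are dense. -/
theorem exists_disjoint_norm_sub_lt (hY : IsALSpace Y) (z : ProjTensor X Y) {ε : ℝ} (hε : 0 < ε) :
    ∃ (κ : Type) (_ : Fintype κ) (h : κ → Y) (x : κ → X), IsDisjointFamily h ∧
      ‖z - sumTmul h x‖ < ε := by
  obtain ⟨ι, _, y, x, hy, hz⟩ := exists_norm_sub_sumTmul_lt z (half_pos hε)
  set M : ℝ := ∑ i, ‖x i‖ with hM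
  have hM0 : 0 ≤ M := by positivity
  obtain ⟨κ, _, g, a, hg, ha, hay⟩ := hY.exists_disjointFamily_approx hy
    (ε := ε / (2 * (M + 1))) (by positivity)
  refine ⟨κ, inferInstance, g, matAct a x, hg, ?_⟩
  have e := norm_sumTmul_sub_le (fun i => (hay i).2) x
  have hb : ε / (2 * (M + 1)) * M ≤ ε / 2 := by
    have : ε / (2 * (M + 1)) * M = ε / 2 * (M / (M + 1)) := by field_simp
    rw [this]
    exact mul_le_of_le_one_right (by positivity) ((div_le_one (by positivity)).2 (by linarith))
  have := norm_sub_le_norm_sub_add_norm_sub z (sumTmul y x) (sumTmul g (matAct a x))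
  linarith

theorem induction_disjoint (hY : IsALSpace Y) {p : ProjTensor X Y → Prop}
    (hp : IsClosed {z | p z})
    (h : ∀ (κ : Type) [Fintype κ] (h : κ → Y) (x : κ → X), IsDisjointFamily h → p (sumTmul h x))
    (z : ProjTensor X Y) : p z := by
  change z ∈ {z | p z}
  rw [← hp.closure_eq, Metric.mem_closure_iff]
  intro ε hε
  obtain ⟨κ, _, g, x, hg, e⟩ := exists_disjoint_norm_sub_lt hY z hε
  exact ⟨_, h κ g x hg, by rwa [dist_eq_norm]⟩

/-- The closed ball is the closure of the open one, so density applies inside the open ball.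
Positive total mass of `h` is needed later to distribute the deficit `1 - ‖t‖`; if it vanishes, the
tensor is zero and is rewritten over the single element `|y|` for some `y ≠ 0`. -/
theorem exists_disjoint_mem_of_isOpen [Nontrivial Y] (hY : IsALSpace Y) {V : Set (ProjTensor X Y)}
    (hV : IsOpen V) (hne : (Metric.closedBall 0 1 ∩ V).Nonempty) :
    ∃ (κ : Type) (_ : Fintype κ) (h : κ → Y) (x : κ → X), IsDisjointFamily h ∧
      sumTmul h x ∈ V ∧ ‖sumTmul h x‖ < 1 ∧ 0 < ∑ k, ‖h k‖ := by
  obtain ⟨z, hz, hzV⟩ := hne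
  rw [← closure_ball (0 : ProjTensor X Y) one_ne_zero] at hz
  obtain ⟨w, hwV, hwb⟩ := mem_closure_iff.1 hz V hV hzV
  obtain ⟨ε, hε, hεV⟩ := Metric.isOpen_iff.1 (hV.inter Metric.isOpen_ball) w ⟨hwV, hwb⟩
  obtain ⟨κ, _, h, x, hh, hwx⟩ := exists_disjoint_norm_sub_lt hY w hε
  obtain ⟨hxV, hxb⟩ := hεV (by rwa [Metric.mem_ball, dist_comm, dist_eq_norm])
  rw [mem_ball_zero_iff] at hxb
  rcases (Finset.sum_nonneg fun k (_ : k ∈ Finset.univ) => norm_nonneg (h k)).eq_or_lt with h0 | h0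
  · obtain ⟨y, hy⟩ := exists_ne (0 : Y)
    have hz0 : sumTmul h x = 0 := by
      have hk := (Finset.sum_eq_zero_iff_of_nonneg fun k _ => norm_nonneg (h k)).1 h0.symm
      refine Finset.sum_eq_zero fun k _ => ?_
      rw [norm_eq_zero.1 (hk k (Finset.mem_univ k)), ← mk_apply, map_zero]
    refine ⟨Unit, inferInstance, fun _ => |y|, 0,
      ⟨fun _ => abs_nonneg y, fun i j hij => absurd (Subsingleton.elim i j) hij⟩, ?_, ?_, ?_⟩
    · rwa [sumTmul_zero, ← hz0]
    · rw [sumTmul_zero, norm_zero]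
      exact one_pos
    · rw [Fintype.sum_unique, norm_abs_eq_norm]
      exact norm_pos_iff.2 hy
  · exact ⟨κ, inferInstance, h, x, hh, hxV, hxb, h0⟩

end Lattice

/-! ### The modulus on tensors over disjoint families is nonexpansive. -/

section Modulus

variable {X Y : Type*} [NormedAddCommGroup X] [NormedSpace ℝ X] [Lattice X] [IsBanachLattice X]
  [NormedAddCommGroup Y] [NormedSpace ℝ Y] [Lattice Y] [IsBanachLattice Y]

theorem abs_smul_of_nonneg' {E : Type*} [NormedAddCommGroup E] [NormedSpace ℝ E] [Lattice E]
    [IsBanachLattice E] {c : ℝ} (hc : 0 ≤ c) (x : E) : |c • x| = c • |x| := by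
  rcases hc.eq_or_lt with rfl | hc
  · simp
  · have := (OrderIso.smulRight (β := E) hc).map_sup x (-x)
    rw [abs, abs, ← smul_neg]
    exact this.symm

theorem abs_sum_smul_of_pairwise {ι : Type*} [Fintype ι] {c : ι → ℝ} (hc : ∀ i, 0 ≤ c i)
    (h : ∀ i j, i ≠ j → c i = 0 ∨ c j = 0) (x : ι → X) :
    |∑ i, c i • x i| = ∑ i, c i • |x i| := by
  by_cases h0 : ∃ i, c i ≠ 0
  · obtain ⟨i, hi⟩ := h0
    have hj : ∀ j, j ≠ i → c j = 0 := fun j hji => (h j i hji).resolve_right hi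
    rw [Finset.sum_eq_single i (fun j _ hji => by simp [hj j hji]) (by simp),
      Finset.sum_eq_single i (fun j _ hji => by simp [hj j hji]) (by simp)]
    exact abs_smul_of_nonneg' (hc i) _
  · push Not at h0
    simp [h0]

/-- The modulus of a combination of a disjoint family, in terms of an approximation from below. -/
theorem sumTmul_matAct_abs {ι κ : Type*} [Fintype ι] [Fintype κ] {y : ι → Y}
    (hy : IsDisjointFamily y) {h : κ → Y} (hh : IsDisjointFamily h) {a : ι → κ → ℝ}
    (ha : ∀ i k, 0 ≤ a i k) (hay : ∀ i, ∑ k, a i k • h k ≤ y i) (x : ι → X) :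
    sumTmul h (matAct a fun i => |x i|) = sumTmul h fun k => |matAct a x k| := by
  refine sumTmul_congr_of_ne_zero fun k hk => ?_
  refine (abs_sum_smul_of_pairwise (fun i => ha i k) (fun i j hij => ?_) x).symm
  have hle : ∀ i, a i k • h k ≤ y i := fun i => (Finset.single_le_sum
    (fun l _ => smul_nonneg (ha i l) (hh.nonneg l)) (Finset.mem_univ k)).trans (hay i)
  -- Below disjoint `y i` and `y j` a common multiple of `h k` must vanish, so on a nonzero cell at
  -- most one coefficient is nonzero and the modulus passes through the sum.
  have hm : (min (a i k) (a j k)) • h k ≤ y i ⊓ y j :=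
    le_inf ((smul_le_smul_of_nonneg_right (min_le_left _ _) (hh.nonneg k)).trans (hle i))
      ((smul_le_smul_of_nonneg_right (min_le_right _ _) (hh.nonneg k)).trans (hle j))
  rw [hy.inf_eq_zero i j hij] at hm
  have h0 := le_antisymm hm (smul_nonneg (le_min (ha i k) (ha j k)) (hh.nonneg k))
  rcases min_choice (a i k) (a j k) with hc | hc <;> rw [hc] at h0
  · exact Or.inl ((smul_eq_zero.1 h0).resolve_right hk)
  · exact Or.inr ((smul_eq_zero.1 h0).resolve_right hk)

theorem norm_sumTmul_abs_sub_abs_le (hY : IsALSpace Y) {κ : Type*} [Fintype κ] {h : κ → Y}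
    (hh : IsDisjointFamily h) (x x' : κ → X) :
    ‖sumTmul h (fun k => |x k|) - sumTmul h fun k => |x' k|‖ ≤ ‖sumTmul h x - sumTmul h x'‖ := by
  rw [← sumTmul_sub, ← sumTmul_sub, norm_sumTmul hY hh, norm_sumTmul hY hh]
  refine Finset.sum_le_sum fun k _ => mul_le_mul_of_nonneg_right ?_ (norm_nonneg _)
  exact norm_abs_sub_abs (x k) (x' k)

/-- The map `∑ xᵢ ⊗ hᵢ ↦ ∑ |xᵢ| ⊗ hᵢ` (`h` disjoint) does not increase distances. -/
theorem norm_sumTmul_abs_sub_sumTmul_abs_le (hY : IsALSpace Y) {ι κ : Type*} [Fintype ι]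
    [Fintype κ] {h : ι → Y} {h' : κ → Y} (hh : IsDisjointFamily h) (hh' : IsDisjointFamily h')
    (x : ι → X) (x' : κ → X) :
    ‖sumTmul h (fun i => |x i|) - sumTmul h' fun k => |x' k|‖ ≤ ‖sumTmul h x - sumTmul h' x'‖ := by
  refine le_of_forall_pos_le_add fun ε hε => ?_
  set M : ℝ := ∑ i, ‖x i‖ + ∑ k, ‖x' k‖ with hM
  have hM0 : 0 ≤ M := by positivity
  set δ : ℝ := ε / (2 * (M + 1)) with hδ
  have hδ0 : 0 < δ := by positivity
  obtain ⟨μ, _, g, a, hg, ha, hay⟩ := hY.exists_disjointFamily_approx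
    (y := Sum.elim h h') (by rintro (i | i); exacts [hh.nonneg i, hh'.nonneg i]) hδ0
  have l1 : ∀ i, ∑ k, a (Sum.inl i) k • g k ≤ h i := fun i => (hay (Sum.inl i)).1
  have l2 : ∀ i, ∑ k, a (Sum.inr i) k • g k ≤ h' i := fun i => (hay (Sum.inr i)).1
  have n1 : ∀ i, ‖h i - ∑ k, a (Sum.inl i) k • g k‖ ≤ δ := fun i => (hay (Sum.inl i)).2
  have n2 : ∀ i, ‖h' i - ∑ k, a (Sum.inr i) k • g k‖ ≤ δ := fun i => (hay (Sum.inr i)).2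
  have e1 := norm_sumTmul_sub_le n1 x
  have e2 := norm_sumTmul_sub_le n2 x'
  have e3 := norm_sumTmul_sub_le n1 fun i => |x i|
  have e4 := norm_sumTmul_sub_le n2 fun i => |x' i|
  simp only [norm_abs_eq_norm] at e3 e4
  rw [sumTmul_matAct_abs hh hg (fun i => ha _) l1] at e3
  rw [sumTmul_matAct_abs hh' hg (fun i => ha _) l2] at e4
  have e5 := norm_sumTmul_abs_sub_abs_le hY hg (matAct (fun i => a (Sum.inl i)) x)
    (matAct (fun i => a (Sum.inr i)) x')
  -- Each tensor is replaced over the common family twice, once itself and once under the modulus,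
  -- for a total error of `2 δ M`; the `M + 1` in `δ` avoids division by zero.
  have hb : δ * M * 2 ≤ ε := by
    rw [hδ]
    have : ε / (2 * (M + 1)) * M * 2 = ε * (M / (M + 1)) := by field_simp
    rw [this]
    exact mul_le_of_le_one_right hε.le ((div_le_one (by positivity)).2 (by linarith))
  have hb' : δ * M * 2 = 2 * (δ * ∑ i, ‖x i‖) + 2 * (δ * ∑ k, ‖x' k‖) := by rw [hM]; ring
  generalize sumTmul g (fun k => |matAct (fun i => a (Sum.inl i)) x k|) = p at *
  generalize sumTmul g (fun k => |matAct (fun i => a (Sum.inr i)) x' k|) = p' at *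
  generalize sumTmul g (matAct (fun i => a (Sum.inl i)) x) = q at *
  generalize sumTmul g (matAct (fun i => a (Sum.inr i)) x') = q' at *
  generalize sumTmul h (fun i => |x i|) = s at *
  generalize sumTmul h' (fun i => |x' i|) = s' at *
  generalize sumTmul h x = t at *
  generalize sumTmul h' x' = t' at *
  have t1 : ‖s - s'‖ ≤ ‖s - p‖ + ‖p - p'‖ + ‖s' - p'‖ := by
    rw [norm_sub_rev s' p']
    exact (norm_sub_le_norm_sub_add_norm_sub s p' s').trans
      (add_le_add (norm_sub_le_norm_sub_add_norm_sub s p p') le_rfl)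
  have t2 : ‖q - q'‖ ≤ ‖t - q‖ + ‖t - t'‖ + ‖t' - q'‖ := by
    rw [norm_sub_rev t q]
    exact (norm_sub_le_norm_sub_add_norm_sub q t' q').trans
      (add_le_add (norm_sub_le_norm_sub_add_norm_sub q t t') le_rfl)
  linarith

end Modulus

end ProjTensor

open Filter Topology in
/-- A nonexpansive relation with dense domain extends to a nonexpansive map. -/
theorem exists_lipschitzWith_of_relation {α β : Type*} [MetricSpace α] [MetricSpace β]
    [CompleteSpace β] (R : α → β → Prop)
    (hd : ∀ z : α, ∀ ε > 0, ∃ z' w', R z' w' ∧ dist z z' < ε)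
    (hR : ∀ z w z' w', R z w → R z' w' → dist w w' ≤ dist z z') :
    ∃ A : α → β, LipschitzWith 1 A ∧ ∀ z w, R z w → A z = w := by
  have hpos : ∀ n : ℕ, 0 < (1 : ℝ) / (n + 1) := fun n => by positivity
  choose p q hpq hdist using fun z (n : ℕ) => hd z _ (hpos n)
  have hp : ∀ z, Tendsto (p z) atTop (𝓝 z) := fun z => by
    rw [tendsto_iff_dist_tendsto_zero]
    refine squeeze_zero (fun _ => dist_nonneg) (fun n => ?_) tendsto_one_div_add_atTop_nhds_zero_nat
    rw [dist_comm]
    exact (hdist z n).le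
  have hq : ∀ z, ∃ w, Tendsto (q z) atTop (𝓝 w) := fun z => by
    refine cauchySeq_tendsto_of_complete ?_
    have hc := (hp z).cauchySeq
    rw [Metric.cauchySeq_iff] at hc ⊢
    intro ε hε
    obtain ⟨N, hN⟩ := hc ε hε
    exact ⟨N, fun m hm n hn => (hR _ _ _ _ (hpq z m) (hpq z n)).trans_lt (hN m hm n hn)⟩
  choose A hA using hq
  refine ⟨A, LipschitzWith.of_dist_le_mul fun z z' => ?_, fun z w hzw => ?_⟩
  · rw [NNReal.coe_one, one_mul]
    exact le_of_tendsto_of_tendsto' ((hA z).dist (hA z')) ((hp z).dist (hp z'))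
      fun n => hR _ _ _ _ (hpq z n) (hpq z' n)
  · refine dist_le_zero.1 ?_
    rw [← dist_self z]
    exact le_of_tendsto_of_tendsto' ((hA z).dist tendsto_const_nhds)
      ((hp z).dist tendsto_const_nhds) fun n => hR _ _ _ _ (hpq z n) hzw

namespace ProjTensor

/-! ### The closed positive cone. -/

section Cone

variable {X Y : Type*} [NormedAddCommGroup X] [NormedSpace ℝ X] [Lattice X]
  [NormedAddCommGroup Y] [NormedSpace ℝ Y] [Lattice Y]

theorem isClosed_positiveCone : IsClosed (positiveCone X Y) := isClosed_closure

theorem add_mem_positiveCone {z w : ProjTensor X Y} (hz : z ∈ positiveCone X Y)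
    (hw : w ∈ positiveCone X Y) : z + w ∈ positiveCone X Y :=
  (AddSubmonoid.closure {z : ProjTensor X Y | ∃ (x : X) (y : Y), 0 ≤ x ∧ 0 ≤ y ∧
    z = ProjTensor.tmul x y}).topologicalClosure.add_mem hz hw

theorem zero_mem_positiveCone : (0 : ProjTensor X Y) ∈ positiveCone X Y :=
  (AddSubmonoid.closure {z : ProjTensor X Y | ∃ (x : X) (y : Y), 0 ≤ x ∧ 0 ≤ y ∧
    z = ProjTensor.tmul x y}).topologicalClosure.zero_mem

theorem tmul_mem_positiveCone {x : X} {y : Y} (hx : 0 ≤ x) (hy : 0 ≤ y) :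
    tmul x y ∈ positiveCone X Y :=
  subset_closure (AddSubmonoid.subset_closure ⟨x, y, hx, hy, rfl⟩)

theorem smul_mem_positiveCone [IsBanachLattice X] {r : ℝ} (hr : 0 ≤ r) {z : ProjTensor X Y}
    (hz : z ∈ positiveCone X Y) : r • z ∈ positiveCone X Y := by
  refine map_mem_closure (continuous_const_smul r) hz fun w hw => ?_
  induction hw using AddSubmonoid.closure_induction with
  | mem w hw =>
    obtain ⟨x, y, hx, hy, rfl⟩ := hw
    exact AddSubmonoid.subset_closure ⟨r • x, y, smul_nonneg hr hx, hy, (smul_tmul' r x y).symm⟩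
  | zero => simp
  | add a b _ _ ha hb =>
    rw [smul_add]
    exact AddSubmonoid.add_mem _ ha hb

theorem sumTmul_mem_positiveCone {κ : Type*} [Fintype κ] {h : κ → Y} {x : κ → X}
    (hh : ∀ k, 0 ≤ h k) (hx : ∀ k, 0 ≤ x k) : sumTmul h x ∈ positiveCone X Y :=
  (AddSubmonoid.closure {z : ProjTensor X Y | ∃ (x : X) (y : Y), 0 ≤ x ∧ 0 ≤ y ∧
    z = ProjTensor.tmul x y}).topologicalClosure.sum_mem
      fun k _ => tmul_mem_positiveCone (hx k) (hh k)

theorem mem_positiveCone_of_forall {z : ProjTensor X Y}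
    (h : ∀ ε > 0, ∃ c ∈ positiveCone X Y, ‖z - c‖ < ε) : z ∈ positiveCone X Y := by
  rw [← isClosed_positiveCone.closure_eq, Metric.mem_closure_iff]
  simpa only [dist_eq_norm] using h

theorem exists_sumTmul_of_mem_positiveCone {z : ProjTensor X Y} (hz : z ∈ positiveCone X Y)
    {ε : ℝ} (hε : 0 < ε) : ∃ (ι : Type) (_ : Fintype ι) (y : ι → Y) (x : ι → X),
      (∀ i, 0 ≤ y i) ∧ (∀ i, 0 ≤ x i) ∧ ‖z - sumTmul y x‖ < ε := by
  obtain ⟨w, hw, hzw⟩ := Metric.mem_closure_iff.1 hz ε hε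
  rw [dist_eq_norm] at hzw
  suffices h : ∃ (ι : Type) (_ : Fintype ι) (y : ι → Y) (x : ι → X),
      (∀ i, 0 ≤ y i) ∧ (∀ i, 0 ≤ x i) ∧ w = sumTmul y x by
    obtain ⟨ι, _, y, x, hy, hx, rfl⟩ := h
    exact ⟨ι, inferInstance, y, x, hy, hx, hzw⟩
  clear hzw
  induction hw using AddSubmonoid.closure_induction with
  | mem w hw =>
    obtain ⟨x, y, hx, hy, rfl⟩ := hw
    exact ⟨Unit, inferInstance, fun _ => y, fun _ => x, fun _ => hy, fun _ => hx, by simp [sumTmul]⟩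
  | zero => exact ⟨Empty, inferInstance, Empty.elim, Empty.elim, by simp, by simp, by simp [sumTmul]⟩
  | add a b _ _ ha hb =>
    obtain ⟨ι, _, y, x, hy, hx, rfl⟩ := ha
    obtain ⟨κ, _, y', x', hy', hx', rfl⟩ := hb
    refine ⟨ι ⊕ κ, inferInstance, Sum.elim y y', Sum.elim x x', ?_, ?_, ?_⟩
    · rintro (i | i)
      exacts [hy i, hy' i]
    · rintro (i | i)
      exacts [hx i, hx' i]
    · rw [sumTmul_sumElim]

end Cone

variable {X Y : Type*} [NormedAddCommGroup X] [NormedSpace ℝ X] [Lattice X] [IsBanachLattice X]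
  [NormedAddCommGroup Y] [NormedSpace ℝ Y] [Lattice Y] [IsBanachLattice Y]

/-! ### Order relations approximated coordinatewise. -/

section Approximation

/-- Two positive elements are simultaneously approximated over one disjoint family. -/
theorem exists_disjoint_of_mem_positiveCone (hY : IsALSpace Y) {z w : ProjTensor X Y}
    (hz : z ∈ positiveCone X Y) (hw : w ∈ positiveCone X Y) {ε : ℝ} (hε : 0 < ε) :
    ∃ (κ : Type) (_ : Fintype κ) (h : κ → Y) (u v : κ → X), IsDisjointFamily h ∧
      (∀ k, 0 ≤ u k) ∧ (∀ k, 0 ≤ v k) ∧ ‖z - sumTmul h u‖ < ε ∧ ‖w - sumTmul h v‖ < ε := by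
  obtain ⟨ι, _, y, x, hy, hx, hzx⟩ := exists_sumTmul_of_mem_positiveCone hz (half_pos hε)
  obtain ⟨ι', _, y', x', hy', hx', hwx⟩ := exists_sumTmul_of_mem_positiveCone hw (half_pos hε)
  set M : ℝ := ∑ i, ‖x i‖ + ∑ i, ‖x' i‖ with hM
  have hS : 0 ≤ ∑ i, ‖x i‖ := by positivity
  have hS' : 0 ≤ ∑ i, ‖x' i‖ := by positivity
  have hM0 : 0 ≤ M := by positivity
  set δ : ℝ := ε / (2 * (M + 1)) with hδ
  have hδ0 : 0 < δ := by positivity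
  obtain ⟨κ, _, g, a, hg, ha, hay⟩ := hY.exists_disjointFamily_approx
    (y := Sum.elim y y') (by rintro (i | i); exacts [hy i, hy' i]) hδ0
  have n1 : ∀ i, ‖y i - ∑ k, a (Sum.inl i) k • g k‖ ≤ δ := fun i => (hay (Sum.inl i)).2
  have n2 : ∀ i, ‖y' i - ∑ k, a (Sum.inr i) k • g k‖ ≤ δ := fun i => (hay (Sum.inr i)).2
  have e1 := norm_sumTmul_sub_le n1 x
  have e2 := norm_sumTmul_sub_le n2 x'
  have hb : δ * M ≤ ε / 2 := by
    have : ε / (2 * (M + 1)) * M = ε / 2 * (M / (M + 1)) := by field_simp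
    rw [hδ, this]
    exact mul_le_of_le_one_right (by positivity) ((div_le_one (by positivity)).2 (by linarith))
  have b1 : δ * ∑ i, ‖x i‖ ≤ δ * M := mul_le_mul_of_nonneg_left (by linarith) hδ0.le
  have b2 : δ * ∑ i, ‖x' i‖ ≤ δ * M := mul_le_mul_of_nonneg_left (by linarith) hδ0.le
  refine ⟨κ, inferInstance, g, matAct (fun i => a (Sum.inl i)) x,
    matAct (fun i => a (Sum.inr i)) x', hg,
    fun k => Finset.sum_nonneg fun i _ => smul_nonneg (ha (Sum.inl i) k) (hx i),
    fun k => Finset.sum_nonneg fun i _ => smul_nonneg (ha (Sum.inr i) k) (hx' i), ?_, ?_⟩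
  · refine (norm_sub_le_norm_sub_add_norm_sub z (sumTmul y x) _).trans_lt ?_
    exact (add_lt_add_of_lt_of_le hzx (e1.trans (b1.trans hb))).trans_eq (add_halves ε)
  · refine (norm_sub_le_norm_sub_add_norm_sub w (sumTmul y' x') _).trans_lt ?_
    exact (add_lt_add_of_lt_of_le hwx (e2.trans (b2.trans hb))).trans_eq (add_halves ε)

/-- Approximate `w + z` and `w - z` by positive tensors over one family, and take half their
difference and half their sum. The tensors are approximate, but the domination `|s k| ≤ t k` is
exact. -/
theorem exists_disjoint_of_add_sub_mem (hY : IsALSpace Y) {z w : ProjTensor X Y}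
    (h₁ : w + z ∈ positiveCone X Y) (h₂ : w - z ∈ positiveCone X Y) {ε : ℝ} (hε : 0 < ε) :
    ∃ (κ : Type) (_ : Fintype κ) (h : κ → Y) (s t : κ → X), IsDisjointFamily h ∧
      (∀ k, |s k| ≤ t k) ∧ ‖z - sumTmul h s‖ < ε ∧ ‖w - sumTmul h t‖ < ε := by
  obtain ⟨κ, _, h, u, v, hh, hu, hv, e1, e2⟩ := exists_disjoint_of_mem_positiveCone hY h₁ h₂ hε
  refine ⟨κ, inferInstance, h, (1 / 2 : ℝ) • (u - v), (1 / 2 : ℝ) • (u + v), hh, fun k => ?_,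
    ?_, ?_⟩
  · rw [abs_le']
    simp only [Pi.smul_apply, Pi.sub_apply, Pi.add_apply, ← smul_neg]
    constructor <;> refine smul_le_smul_of_nonneg_left ?_ (by norm_num)
    · exact sub_le_self_iff _ |>.2 (hv k) |>.trans (le_add_of_nonneg_right (hv k))
    · rw [neg_sub]
      exact (sub_le_self _ (hu k)).trans (le_add_of_nonneg_left (hu k))
  · have e : z - sumTmul h ((1 / 2 : ℝ) • (u - v)) =
        (1 / 2 : ℝ) • ((w + z - sumTmul h u) - (w - z - sumTmul h v)) := by
      rw [sumTmul_smul, sumTmul_sub]; module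
    rw [e, norm_smul]
    have := norm_sub_le (w + z - sumTmul h u) (w - z - sumTmul h v)
    norm_num
    linarith
  · have e : w - sumTmul h ((1 / 2 : ℝ) • (u + v)) =
        (1 / 2 : ℝ) • ((w + z - sumTmul h u) + (w - z - sumTmul h v)) := by
      rw [sumTmul_smul, sumTmul_add]; module
    rw [e, norm_smul]
    have := norm_add_le (w + z - sumTmul h u) (w - z - sumTmul h v)
    norm_num
    linarith

/-- Solidity of the norm, expressed through the cone alone since no lattice structure exists yet.
With `w = 0` it shows that the cone is pointed. -/
theorem norm_le_of_add_sub_mem (hY : IsALSpace Y) {z w : ProjTensor X Y}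
    (h₁ : w + z ∈ positiveCone X Y) (h₂ : w - z ∈ positiveCone X Y) : ‖z‖ ≤ ‖w‖ := by
  refine le_of_forall_pos_le_add fun ε hε => ?_
  obtain ⟨κ, _, h, s, t, hh, hst, e1, e2⟩ := exists_disjoint_of_add_sub_mem hY h₁ h₂ (half_pos hε)
  have h3 : ‖sumTmul h s‖ ≤ ‖sumTmul h t‖ := by
    rw [norm_sumTmul hY hh, norm_sumTmul hY hh]
    refine Finset.sum_le_sum fun k _ => mul_le_mul_of_nonneg_right ?_ (norm_nonneg _)
    exact HasSolidNorm.solid ((hst k).trans (le_abs_self _))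
  have h4 := norm_le_norm_add_norm_sub' z (sumTmul h s)
  have h5 := norm_le_norm_add_norm_sub w (sumTmul h t)
  linarith

end Approximation

/-! ### The modulus on the completed tensor product, and the Banach lattice it yields. -/

section Modulus

theorem exists_modulus (hY : IsALSpace Y) : ∃ A : ProjTensor X Y → ProjTensor X Y,
    LipschitzWith 1 A ∧ ∀ (κ : Type) (_ : Fintype κ) (h : κ → Y) (x : κ → X),
      IsDisjointFamily h → A (sumTmul h x) = sumTmul h fun k => |x k| := by
  refine (exists_lipschitzWith_of_relation
    (fun z w : ProjTensor X Y => ∃ (κ : Type) (_ : Fintype κ) (h : κ → Y) (x : κ → X),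
      IsDisjointFamily h ∧ z = sumTmul h x ∧ w = sumTmul h fun k => |x k|)
    (fun z ε hε => ?_) ?_).imp fun A hA =>
      ⟨hA.1, fun κ _ h x hh => hA.2 _ _ ⟨κ, inferInstance, h, x, hh, rfl, rfl⟩⟩
  · obtain ⟨κ, _, h, x, hh, e⟩ := exists_disjoint_norm_sub_lt hY z hε
    exact ⟨_, _, ⟨κ, inferInstance, h, x, hh, rfl, rfl⟩, by rwa [dist_eq_norm]⟩
  · rintro _ _ _ _ ⟨κ, _, h, x, hh, rfl, rfl⟩ ⟨κ', _, h', x', hh', rfl, rfl⟩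
    rw [dist_eq_norm, dist_eq_norm]
    exact norm_sumTmul_abs_sub_sumTmul_abs_le hY hh hh' x x'

/-- The modulus of the projective tensor product of a Banach lattice and an AL-space. -/
def modulus (hY : IsALSpace Y) : ProjTensor X Y → ProjTensor X Y := (exists_modulus hY).choose

theorem lipschitzWith_modulus (hY : IsALSpace Y) :
    LipschitzWith 1 (modulus hY : ProjTensor X Y → ProjTensor X Y) :=
  (exists_modulus hY).choose_spec.1

theorem modulus_sumTmul (hY : IsALSpace Y) {κ : Type} [Fintype κ] {h : κ → Y}
    (hh : IsDisjointFamily h) (x : κ → X) :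
    modulus hY (sumTmul h x) = sumTmul h fun k => |x k| :=
  (exists_modulus hY).choose_spec.2 κ inferInstance h x hh

theorem modulus_add_mem (hY : IsALSpace Y) (z : ProjTensor X Y) :
    modulus hY z + z ∈ positiveCone X Y := by
  refine induction_disjoint (p := fun z => modulus hY z + z ∈ positiveCone X Y) hY
    (isClosed_positiveCone.preimage ((lipschitzWith_modulus hY).continuous.add continuous_id))
    (fun κ _ h x hh => ?_) z
  · rw [modulus_sumTmul hY hh, ← sumTmul_add]
    refine sumTmul_mem_positiveCone hh.nonneg fun k => ?_
    simpa [← neg_le_iff_add_nonneg] using neg_le_abs (x k)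

theorem modulus_sub_mem (hY : IsALSpace Y) (z : ProjTensor X Y) :
    modulus hY z - z ∈ positiveCone X Y := by
  refine induction_disjoint (p := fun z => modulus hY z - z ∈ positiveCone X Y) hY
    (isClosed_positiveCone.preimage ((lipschitzWith_modulus hY).continuous.sub continuous_id))
    (fun κ _ h x hh => ?_) z
  · rw [modulus_sumTmul hY hh, ← sumTmul_sub]
    exact sumTmul_mem_positiveCone hh.nonneg fun k => sub_nonneg.2 (le_abs_self (x k))

theorem norm_modulus (hY : IsALSpace Y) (z : ProjTensor X Y) : ‖modulus hY z‖ = ‖z‖ := by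
  refine induction_disjoint (p := fun z => ‖modulus hY z‖ = ‖z‖) hY
    (isClosed_eq (lipschitzWith_modulus hY).continuous.norm continuous_norm)
    (fun κ _ h x hh => ?_) z
  · rw [modulus_sumTmul hY hh, norm_sumTmul hY hh, norm_sumTmul hY hh]
    simp only [norm_abs_eq_norm]

theorem modulus_mem (hY : IsALSpace Y) (z : ProjTensor X Y) :
    modulus hY z ∈ positiveCone X Y := by
  have h := smul_mem_positiveCone (r := 1 / 2) (by norm_num)
    (add_mem_positiveCone (modulus_add_mem hY z) (modulus_sub_mem hY z))
  have e : (1 / 2 : ℝ) • (modulus hY z + z + (modulus hY z - z)) = modulus hY z := by module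
  rwa [e] at h

/-- Leastness of the modulus among the upper bounds of `z` and `-z`: it holds coordinatewise over a
disjoint family, and nonexpansiveness carries it to the limit. -/
theorem sub_modulus_mem (hY : IsALSpace Y) {z w : ProjTensor X Y}
    (h₁ : w + z ∈ positiveCone X Y) (h₂ : w - z ∈ positiveCone X Y) :
    w - modulus hY z ∈ positiveCone X Y := by
  refine mem_positiveCone_of_forall fun ε hε => ?_
  obtain ⟨κ, _, h, s, t, hh, hst, e1, e2⟩ := exists_disjoint_of_add_sub_mem hY h₁ h₂ (half_pos hε)
  refine ⟨sumTmul h (t - fun k => |s k|),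
    sumTmul_mem_positiveCone hh.nonneg fun k => sub_nonneg.2 (hst k), ?_⟩
  have h3 := (lipschitzWith_modulus hY).dist_le_mul z (sumTmul h s)
  rw [modulus_sumTmul hY hh, dist_eq_norm, dist_eq_norm, NNReal.coe_one, one_mul] at h3
  have e : w - modulus hY z - sumTmul h (t - fun k => |s k|) =
      (w - sumTmul h t) - (modulus hY z - sumTmul h fun k => |s k|) := by
    rw [sumTmul_sub]; abel
  rw [e]
  have := norm_sub_le (w - sumTmul h t) (modulus hY z - sumTmul h fun k => |s k|)
  linarith

end Modulus

/-- The lattice structure on the projective tensor product with an AL-space. -/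
@[reducible]
def lattice (hY : IsALSpace Y) : Lattice (ProjTensor X Y) where
  le z w := w - z ∈ positiveCone X Y
  le_refl z := by rw [sub_self]; exact zero_mem_positiveCone
  le_trans a b c hab hbc := by
    rw [← sub_add_sub_cancel c b a]
    exact add_mem_positiveCone hbc hab
  le_antisymm a b hab hba := by
    have h := norm_le_of_add_sub_mem hY (z := b - a) (w := 0) (by rwa [zero_add])
      (by rwa [zero_sub, neg_sub])
    rw [norm_zero] at h
    exact (sub_eq_zero.1 (norm_le_zero_iff.1 h)).symm
  -- The formulas `(z + w ± |z - w|) / 2` valid in any real vector lattice.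
  sup z w := (1 / 2 : ℝ) • (z + w + modulus hY (z - w))
  inf z w := (1 / 2 : ℝ) • (z + w - modulus hY (z - w))
  le_sup_left a b := by
    have h := smul_mem_positiveCone (r := 1 / 2) (by norm_num) (modulus_sub_mem hY (a - b))
    have e : (1 / 2 : ℝ) • (modulus hY (a - b) - (a - b)) =
      (1 / 2 : ℝ) • (a + b + modulus hY (a - b)) - a := by module
    rwa [e] at h
  le_sup_right a b := by
    have h := smul_mem_positiveCone (r := 1 / 2) (by norm_num) (modulus_add_mem hY (a - b))
    have e : (1 / 2 : ℝ) • (modulus hY (a - b) + (a - b)) =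
      (1 / 2 : ℝ) • (a + b + modulus hY (a - b)) - b := by module
    rwa [e] at h
  sup_le a b c hac hbc := by
    have h := smul_mem_positiveCone (r := 1 / 2) (by norm_num)
      (sub_modulus_mem hY (z := a - b) (w := (c - a) + (c - b)) ?_ ?_)
    · have e : (1 / 2 : ℝ) • ((c - a) + (c - b) - modulus hY (a - b)) =
        c - (1 / 2 : ℝ) • (a + b + modulus hY (a - b)) := by module
      rwa [e] at h
    · have e : (c - a) + (c - b) + (a - b) = (c - b) + (c - b) := by abel
      rw [e]
      exact add_mem_positiveCone hbc hbc
    · have e : (c - a) + (c - b) - (a - b) = (c - a) + (c - a) := by abel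
      rw [e]
      exact add_mem_positiveCone hac hac
  inf_le_left a b := by
    have h := smul_mem_positiveCone (r := 1 / 2) (by norm_num) (modulus_add_mem hY (a - b))
    have e : (1 / 2 : ℝ) • (modulus hY (a - b) + (a - b)) =
      a - (1 / 2 : ℝ) • (a + b - modulus hY (a - b)) := by module
    rwa [e] at h
  inf_le_right a b := by
    have h := smul_mem_positiveCone (r := 1 / 2) (by norm_num) (modulus_sub_mem hY (a - b))
    have e : (1 / 2 : ℝ) • (modulus hY (a - b) - (a - b)) =
      b - (1 / 2 : ℝ) • (a + b - modulus hY (a - b)) := by module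
    rwa [e] at h
  le_inf c a b hca hcb := by
    have h := smul_mem_positiveCone (r := 1 / 2) (by norm_num)
      (sub_modulus_mem hY (z := a - b) (w := (a - c) + (b - c)) ?_ ?_)
    · have e : (1 / 2 : ℝ) • ((a - c) + (b - c) - modulus hY (a - b)) =
        (1 / 2 : ℝ) • (a + b - modulus hY (a - b)) - c := by module
      rwa [e] at h
    · have e : (a - c) + (b - c) + (a - b) = (a - c) + (a - c) := by abel
      rw [e]
      exact add_mem_positiveCone hca hca
    · have e : (a - c) + (b - c) - (a - b) = (b - c) + (b - c) := by abel
      rw [e]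
      exact add_mem_positiveCone hcb hcb

theorem lattice_le_iff (hY : IsALSpace Y) (z w : ProjTensor X Y) :
    (lattice hY).le z w ↔ w - z ∈ positiveCone X Y := Iff.rfl

theorem isBanachLattice (hY : IsALSpace Y) :
    letI : Lattice (ProjTensor X Y) := lattice hY
    IsBanachLattice (ProjTensor X Y) := by
  let : Lattice (ProjTensor X Y) := lattice hY
  have hle : ∀ z w : ProjTensor X Y, z ≤ w ↔ w - z ∈ positiveCone X Y := lattice_le_iff hY
  have hadd : IsOrderedAddMonoid (ProjTensor X Y) :=
    { add_le_add_left := fun a b hab c => by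
        rw [hle] at hab ⊢
        simpa using hab }
  -- The lattice modulus `z ⊔ -z` unfolds to this expression; no homogeneity of `modulus` is
  -- required, as its norm and positivity suffice.
  have habs : ∀ z : ProjTensor X Y, |z| = (1 / 2 : ℝ) • modulus hY (z + z) := fun z => by
    change (1 / 2 : ℝ) • (z + -z + modulus hY (z - -z)) = _
    rw [add_neg_cancel, zero_add, sub_neg_eq_add]
  have hmem : ∀ z : ProjTensor X Y, |z| ∈ positiveCone X Y := fun z => by
    rw [habs]
    exact smul_mem_positiveCone (by norm_num) (modulus_mem hY _)
  have hnorm : ∀ z : ProjTensor X Y, ‖|z|‖ = ‖z‖ := fun z => by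
    rw [habs, norm_smul, norm_modulus, ← two_smul ℝ z, norm_smul, ← mul_assoc, ← norm_mul]
    norm_num
  have hmod : IsOrderedModule ℝ (ProjTensor X Y) := by
    refine IsOrderedModule.of_smul_nonneg fun r hr z hz => ?_
    rw [hle, sub_zero] at hz ⊢
    exact smul_mem_positiveCone hr hz
  have hsolid : HasSolidNorm (ProjTensor X Y) := ⟨fun z w hzw => by
    rw [hle] at hzw
    rw [← hnorm z, ← hnorm w]
    exact norm_le_of_add_sub_mem hY (add_mem_positiveCone (hmem w) (hmem z)) hzw⟩
  exact { }

end ProjTensor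

/-! ### Almost square spaces: homogeneous form and weakly small directions. -/

section AlmostSquare

variable {X : Type*} [NormedAddCommGroup X] [NormedSpace ℝ X]

/-- A point `(α, β)` of the unit square is a combination of `(1, 1)` and `(1, -1)` whose
coefficients have absolute sum `max |α| |β|`. -/
theorem norm_smul_add_smul_le {u y : X} {c α β : ℝ} (h₁ : ‖u + y‖ ≤ c) (h₂ : ‖u - y‖ ≤ c)
    (hα : |α| ≤ 1) (hβ : |β| ≤ 1) : ‖α • u + β • y‖ ≤ c := by
  have hc : 0 ≤ c := (norm_nonneg _).trans h₁
  have e : α • u + β • y = ((α + β) / 2) • (u + y) + ((α - β) / 2) • (u - y) := by module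
  have hp : |(α + β) / 2| + |(α - β) / 2| ≤ 1 := by
    rw [abs_le] at hα hβ
    rcases abs_cases ((α + β) / 2) with ⟨h, -⟩ | ⟨h, -⟩ <;>
      rcases abs_cases ((α - β) / 2) with ⟨h', -⟩ | ⟨h', -⟩ <;> rw [h, h'] <;> linarith
  rw [e]
  refine (norm_add_le _ _).trans ?_
  rw [norm_smul, norm_smul, Real.norm_eq_abs, Real.norm_eq_abs]
  calc _ ≤ |(α + β) / 2| * c + |(α - β) / 2| * c := by gcongr
    _ = (|(α + β) / 2| + |(α - β) / 2|) * c := by ring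
    _ ≤ 1 * c := by gcongr
    _ = c := one_mul c

variable [Lattice X] [Nontrivial X]

theorem IsASQPlus.exists_norm_add_smul_le (hX : IsASQPlus X) {ι : Type*} [Fintype ι] (x : ι → X)
    {ε : ℝ} (hε : 0 < ε) : ∃ y : X, 0 ≤ y ∧ ‖y‖ = 1 ∧
      ∀ i (r : ℝ), ‖x i + r • y‖ ≤ (1 + ε) * max ‖x i‖ |r| := by
  classical
  obtain ⟨u₀, hu₀⟩ := exists_norm_eq X zero_le_one
  -- Zero vectors cannot be normalised and are replaced by a unit vector; the extra index keeps the
  -- family nonempty.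
  let w : Option ι → X := fun o => o.elim u₀ fun i => if x i = 0 then u₀ else ‖x i‖⁻¹ • x i
  have hw : ∀ o, ‖w o‖ = 1 := by
    rintro (_ | i)
    · exact hu₀
    · change ‖if x i = 0 then u₀ else ‖x i‖⁻¹ • x i‖ = 1
      split_ifs with h
      · exact hu₀
      · rw [norm_smul, norm_inv, norm_norm, inv_mul_cancel₀ (norm_ne_zero_iff.2 h)]
  obtain ⟨y, hy, hy1, hyw⟩ := hX (Fintype.card (Option ι)) Fintype.card_pos
    (fun n => w ((Fintype.equivFin _).symm n)) (fun n => hw _) ε hε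
  refine ⟨y, hy, hy1, fun i r => ?_⟩
  obtain ⟨h1, h2⟩ := hyw (Fintype.equivFin _ (some i))
  rw [Equiv.symm_apply_apply] at h1 h2
  change ‖(if x i = 0 then u₀ else ‖x i‖⁻¹ • x i) + y‖ ≤ 1 + ε at h1
  change ‖(if x i = 0 then u₀ else ‖x i‖⁻¹ • x i) - y‖ ≤ 1 + ε at h2
  by_cases h : x i = 0
  · rw [h, zero_add, norm_smul, hy1, mul_one, norm_zero, max_eq_right (abs_nonneg r),
      Real.norm_eq_abs]
    exact le_mul_of_one_le_left (abs_nonneg r) (by linarith)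
  · rw [if_neg h] at h1 h2
    have hx : 0 < ‖x i‖ := norm_pos_iff.2 h
    set m : ℝ := max ‖x i‖ |r| with hm
    have hm0 : 0 < m := hx.trans_le (le_max_left _ _)
    have e : x i + r • y = m • ((‖x i‖ / m) • (‖x i‖⁻¹ • x i) + (r / m) • y) := by
      rw [smul_add, smul_smul, smul_smul, smul_smul, mul_div_cancel₀ _ hm0.ne',
        mul_div_cancel₀ _ hm0.ne', mul_inv_cancel₀ hx.ne', one_smul]
    rw [e, norm_smul, Real.norm_of_nonneg hm0.le, mul_comm]
    refine mul_le_mul_of_nonneg_right (norm_smul_add_smul_le h1 h2 ?_ ?_) hm0.le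
    · rw [abs_of_nonneg (by positivity)]
      exact (div_le_one hm0).2 (le_max_left _ _)
    · rw [abs_div, abs_of_pos hm0]
      exact (div_le_one hm0).2 (le_max_right _ _)

/-- Iterating the defining property gives finite sequences that behave like the basis of `c₀`. -/
theorem IsASQPlus.exists_sequence (hX : IsASQPlus X) {ι : Type*} [Fintype ι] (x : ι → X)
    {δ : ℝ} (hδ : 0 < δ) (N : ℕ) : ∃ y : Fin N → X, (∀ k, 0 ≤ y k) ∧ (∀ k, ‖y k‖ = 1) ∧
      (∀ k i (r : ℝ), ‖x i + r • y k‖ ≤ (1 + δ) * max ‖x i‖ |r|) ∧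
      ∀ σ : Fin N → ℤˣ, ‖∑ k, ((σ k : ℤ) : ℝ) • y k‖ ≤ (1 + δ) ^ N := by
  induction N with
  | zero => exact ⟨Fin.elim0, by simp, by simp, by simp, by simp⟩
  | succ N ih =>
    obtain ⟨y, hy, hy1, hyx, hσ⟩ := ih
    -- The new vector is almost square to all `2 ^ N` signed sums of its predecessors as well, so
    -- each extension costs one factor `1 + δ`.
    obtain ⟨v, hv, hv1, hvx⟩ := hX.exists_norm_add_smul_le
      (Sum.elim x fun σ : Fin N → ℤˣ => ∑ k, ((σ k : ℤ) : ℝ) • y k) hδ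
    refine ⟨Fin.cons v y, ?_, ?_, ?_, fun σ => ?_⟩
    · exact fun k => Fin.cases hv hy k
    · exact fun k => Fin.cases hv1 hy1 k
    · exact fun k => Fin.cases (fun i => hvx (Sum.inl i)) hyx k
    · rw [Fin.sum_univ_succ, add_comm]
      simp only [Fin.cons_zero, Fin.cons_succ]
      have h1 : |((σ 0 : ℤ) : ℝ)| = 1 := by
        rcases Int.units_eq_one_or (σ 0) with h | h <;> simp [h]
      refine (hvx (Sum.inr fun k => σ k.succ) _).trans ?_
      rw [h1, pow_succ, mul_comm]
      refine mul_le_mul_of_nonneg_right (max_le (hσ _) ?_) (by linarith)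
      exact one_le_pow₀ (by linarith)

/-- Along a `c₀`-like sequence each functional satisfies `∑ |f (y k)| ≤ e ‖f‖`, whatever the length.
For a long sequence, averaging over `k` gives one `y k` on which all functionals in `S` are small.
-/
theorem IsASQPlus.exists_abs_apply_le (hX : IsASQPlus X) {ι : Type*} [Fintype ι] (x : ι → X)
    (S : Finset (StrongDual ℝ X)) {ε : ℝ} (hε : 0 < ε) : ∃ y : X, 0 ≤ y ∧ ‖y‖ = 1 ∧
      (∀ i (r : ℝ), ‖x i + r • y‖ ≤ (1 + ε) * max ‖x i‖ |r|) ∧ ∀ f ∈ S, |f y| ≤ ε := by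
  obtain ⟨N, hN⟩ := exists_nat_gt ((∑ f ∈ S, ‖f‖ * Real.exp 1) / ε)
  rw [div_lt_iff₀ hε] at hN
  -- The bound `1 / (N + 1)` keeps `(1 + δ) ^ N` below `e`.
  set δ : ℝ := min ε (1 / (N + 1)) with hδ
  have hδ0 : 0 < δ := lt_min hε (by positivity)
  have hδN : (1 + δ) ^ N ≤ Real.exp 1 := by
    calc (1 + δ) ^ N ≤ Real.exp δ ^ N := by
          gcongr
          rw [add_comm]
          exact Real.add_one_le_exp δ
      _ = Real.exp (N * δ) := (Real.exp_nat_mul δ N).symm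
      _ ≤ Real.exp 1 := by
          refine Real.exp_le_exp.2 ?_
          calc N * δ ≤ N * (1 / (N + 1)) := by gcongr; exact min_le_right _ _
            _ ≤ 1 := by
              rw [mul_one_div, div_le_one (by positivity)]
              linarith
  obtain ⟨y, hy, hy1, hyx, hσ⟩ := hX.exists_sequence x hδ0 N
  have hf : ∀ f : StrongDual ℝ X, ∑ k, |f (y k)| ≤ ‖f‖ * Real.exp 1 := fun f => by
    classical
    let σ : Fin N → ℤˣ := fun k => if 0 ≤ f (y k) then 1 else -1
    have e : ∑ k, |f (y k)| = f (∑ k, ((σ k : ℤ) : ℝ) • y k) := by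
      rw [map_sum]
      refine Finset.sum_congr rfl fun k _ => ?_
      by_cases h : 0 ≤ f (y k)
      · simp [σ, h]
      · simp [σ, h, abs_of_neg (not_le.1 h)]
    rw [e]
    refine (le_abs_self _).trans ((f.le_opNorm _).trans ?_)
    exact mul_le_mul_of_nonneg_left ((hσ σ).trans hδN) (norm_nonneg f)
  obtain ⟨k, hk⟩ : ∃ k, ∑ f ∈ S, |f (y k)| ≤ ε := by
    by_contra! h
    have h1 : ∑ k : Fin N, ε ≤ ∑ k, ∑ f ∈ S, |f (y k)| := Finset.sum_le_sum fun k _ => (h k).le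
    rw [Finset.sum_comm] at h1
    have h2 := h1.trans (Finset.sum_le_sum fun f _ => hf f)
    simp only [Finset.sum_const, Finset.card_univ, Fintype.card_fin, nsmul_eq_mul] at h2
    linarith
  refine ⟨y k, hy k, hy1 k, fun i r => (hyx k i r).trans ?_, fun f hfS => ?_⟩
  · gcongr
    exact min_le_left _ _
  · exact (Finset.single_le_sum (f := fun f : StrongDual ℝ X => |f (y k)|)
      (fun f _ => abs_nonneg _) hfS).trans hk

end AlmostSquare

open Filter Topology in
theorem tendsto_toWeakSpace {E α : Type*} [NormedAddCommGroup E] [NormedSpace ℝ E] {l : Filter α}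
    {p : α → E} {z : E} (h : ∀ F : StrongDual ℝ E, Tendsto (fun a => F (p a)) l (𝓝 (F z))) :
    Tendsto (fun a => toWeakSpace ℝ E (p a)) l (𝓝 (toWeakSpace ℝ E z)) := by
  have hi : IsInducing fun (x : WeakSpace ℝ E) (F : StrongDual ℝ E) =>
      F ((toWeakSpace ℝ E).symm x) := ⟨rfl⟩
  rw [hi.tendsto_nhds_iff, tendsto_pi_nhds]
  exact h

/-! ### LASQ₊ and the diameter two property of the tensor product. -/

namespace ProjTensor

variable {X Y : Type*} [NormedAddCommGroup X] [NormedSpace ℝ X] [Lattice X] [Nontrivial X]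
  [NormedAddCommGroup Y] [NormedSpace ℝ Y] [Lattice Y] [IsBanachLattice Y]

theorem exists_positive_norm_add_sub_le [IsBanachLattice X] (hX : IsASQPlus X) (hY : IsALSpace Y)
    {u : ProjTensor X Y} (hu : ‖u‖ = 1) {ε : ℝ} (hε : 0 < ε) :
    ∃ z ∈ positiveCone X Y, ‖z‖ = 1 ∧ ‖u + z‖ ≤ 1 + ε ∧ ‖u - z‖ ≤ 1 + ε := by
  -- The total error is `η + (1 + η)² + η ≤ 1 + 5 η`: approximation, almost squareness,
  -- renormalisation. The cap `1 / 2` keeps `‖t‖` positive.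
  set η : ℝ := min (ε / 5) (1 / 2) with hη
  have hη0 : 0 < η := lt_min (by positivity) (by norm_num)
  have hη1 : η ≤ 1 / 2 := min_le_right _ _
  have hηε : 5 * η ≤ ε := by linarith [min_le_left (ε / 5) (1 / 2)]
  obtain ⟨κ, _, h, x, hh, hux⟩ := exists_disjoint_norm_sub_lt hY u hη0
  obtain ⟨y, hy, hy1, hyx⟩ := hX.exists_norm_add_smul_le x hη0
  have hN := norm_sumTmul hY hh x
  have hW := norm_sumTmul_smul_const hY hh (fun k => norm_nonneg (x k)) hy1
  have h1 := norm_sumTmul_add_smul_le (h := h) hyx (r := fun k => ‖x k‖) (s := fun k => ‖x k‖)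
    (fun k => abs_norm _) fun _ => le_rfl
  have h2 := norm_sumTmul_add_smul_le (h := h) hyx (r := fun k => ‖x k‖) (s := fun k => -‖x k‖)
    (fun k => by rw [abs_neg, abs_norm]) fun _ => le_rfl
  have e2 : (sumTmul h fun k => -‖x k‖ • y) = -sumTmul h fun k => ‖x k‖ • y := by
    rw [← sumTmul_neg]
    simp only [neg_smul]
    rfl
  rw [e2, ← sub_eq_add_neg] at h2
  have hmem : (sumTmul h fun k => ‖x k‖ • y) ∈ positiveCone X Y :=
    sumTmul_mem_positiveCone hh.nonneg fun k => smul_nonneg (norm_nonneg _) hy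
  rw [← hN] at hW h1 h2
  generalize sumTmul h (fun k => ‖x k‖ • y) = w at *
  generalize sumTmul h x = t at *
  have ht1 : 1 - η ≤ ‖t‖ := by
    have := norm_sub_norm_le u t
    linarith
  have ht2 : ‖t‖ ≤ 1 + η := by
    have := norm_sub_norm_le t u
    rw [norm_sub_rev] at this
    linarith
  have ht0 : 0 < ‖t‖ := by linarith
  have hz : ‖w - ‖t‖⁻¹ • w‖ ≤ η := by
    have e : w - ‖t‖⁻¹ • w = (1 - ‖t‖⁻¹) • w := by module
    have e' : |1 - ‖t‖⁻¹| * ‖t‖ = |‖t‖ - 1| := by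
      nth_rw 2 [← abs_norm t]
      rw [← abs_mul, sub_mul, inv_mul_cancel₀ ht0.ne', one_mul]
    rw [e, norm_smul, hW, Real.norm_eq_abs, e', abs_le]
    constructor <;> linarith
  have hsq : η + (1 + η) * ‖t‖ + η ≤ 1 + ε := by nlinarith
  refine ⟨‖t‖⁻¹ • w, smul_mem_positiveCone (by positivity) hmem, ?_, ?_, ?_⟩
  · rw [norm_smul, hW, norm_inv, norm_norm, inv_mul_cancel₀ ht0.ne']
  · have e : u + ‖t‖⁻¹ • w = (u - t) + (t + w) - (w - ‖t‖⁻¹ • w) := by abel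
    rw [e]
    have := norm_sub_le ((u - t) + (t + w)) (w - ‖t‖⁻¹ • w)
    have := norm_add_le (u - t) (t + w)
    linarith
  · have e : u - ‖t‖⁻¹ • w = (u - t) + (t - w) + (w - ‖t‖⁻¹ • w) := by abel
    rw [e]
    have := norm_add_le ((u - t) + (t - w)) (w - ‖t‖⁻¹ • w)
    have := norm_add_le (u - t) (t - w)
    linarith

open Filter Topology in
-- Around a simple tensor `t` in the open set, the perturbations `z d = ∑ rₖ y_d ⊗ hₖ` have norm one
-- and tend weakly to zero, while `‖t ± z d‖` is at most `1 + o(1)`. After scaling, both points are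
-- in the set and their distance tends to `2`.
theorem hasDiameterTwoProperty [Nontrivial Y] (hX : IsASQPlus X) (hY : IsALSpace Y) :
    HasDiameterTwoProperty (ProjTensor X Y) := by
  classical
  intro U hU hne
  set B : Set (ProjTensor X Y) := Metric.closedBall 0 1 ∩ toWeakSpace ℝ (ProjTensor X Y) ⁻¹' U
    with hB
  have hbdd : Bornology.IsBounded B := Metric.isBounded_closedBall.subset Set.inter_subset_left
  refine le_antisymm ?_ ?_
  · refine (Metric.diam_mono Set.inter_subset_left Metric.isBounded_closedBall).trans ?_
    simpa using Metric.diam_closedBall (x := (0 : ProjTensor X Y)) zero_le_one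
  obtain ⟨κ, _, h, x, hh, hxU, hx1, hh0⟩ := exists_disjoint_mem_of_isOpen hY
    (hU.preimage (toWeakSpaceCLM ℝ (ProjTensor X Y)).continuous) hne
  set t : ProjTensor X Y := sumTmul h x with ht
  -- Raising every weight by `c` uses up exactly the deficit `1 - ‖t‖`, so that `∑ r k * ‖h k‖ = 1`.
  set c : ℝ := (1 - ‖t‖) / ∑ k, ‖h k‖ with hc
  have hc0 : 0 ≤ c := div_nonneg (by linarith) hh0.le
  set r : κ → ℝ := fun k => ‖x k‖ + c with hr
  have hr0 : ∀ k, 0 ≤ r k := fun k => by positivity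
  have hxr : ∀ k, ‖x k‖ ≤ r k := fun k => le_add_of_nonneg_right hc0
  have hsum : ∑ k, r k * ‖h k‖ = 1 := by
    simp only [hr, add_mul, Finset.sum_add_distrib]
    rw [← norm_sumTmul hY hh x, ← Finset.mul_sum, hc, div_mul_cancel₀ _ hh0.ne']
    ring
  have hpos : ∀ n : ℕ, 0 < (1 : ℝ) / (n + 1) := fun n => by positivity
  -- Indexing by finite sets of functionals together with a precision gives a net, since the weak
  -- topology need not be sequential.
  choose y hy hy1 hyx hyf using fun d : Finset (StrongDual ℝ X) × ℕ =>
    hX.exists_abs_apply_le x d.1 (hpos d.2)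
  set l : Filter (Finset (StrongDual ℝ X) × ℕ) := atTop with hl
  have hε : Tendsto (fun d : Finset (StrongDual ℝ X) × ℕ => (1 : ℝ) / (d.2 + 1)) l (𝓝 0) := by
    refine (tendsto_one_div_add_atTop_nhds_zero_nat (𝕜 := ℝ)).comp ?_
    rw [hl, ← prod_atTop_atTop_eq]
    exact tendsto_snd
  have hscale : Tendsto (fun d : Finset (StrongDual ℝ X) × ℕ => (1 + (1 : ℝ) / (d.2 + 1))⁻¹) l
      (𝓝 1) := by
    simpa using (hε.const_add 1).inv₀ (by norm_num)
  have hweak : ∀ f : StrongDual ℝ X, Tendsto (fun d => f (y d)) l (𝓝 0) := fun f => by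
    refine squeeze_zero_norm' ?_ hε
    filter_upwards [eventually_ge_atTop (({f} : Finset (StrongDual ℝ X)), 0)] with d hd
    exact hyf d f (hd.1 (Finset.mem_singleton_self f))
  set z : Finset (StrongDual ℝ X) × ℕ → ProjTensor X Y := fun d => sumTmul h fun k => r k • y d
    with hz
  have hzn : ∀ d, ‖z d‖ = 1 := fun d => by
    rw [hz]
    exact (norm_sumTmul_smul_const hY hh hr0 (hy1 d)).trans hsum
  have hzF : ∀ F : StrongDual ℝ (ProjTensor X Y), Tendsto (fun d => F (z d)) l (𝓝 0) := fun F => by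
    -- Fixing the second factor turns `F` into finitely many functionals on `X`, so weak nullity of
    -- `y` in `X` suffices.
    let g : κ → StrongDual ℝ X := fun k =>
      LinearMap.mkContinuous ((F : ProjTensor X Y →ₗ[ℝ] ℝ) ∘ₗ (mk X Y).flip (h k)) (‖F‖ * ‖h k‖)
        fun v => by
          refine (F.le_opNorm _).trans ?_
          rw [mul_assoc, mul_comm ‖h k‖]
          exact mul_le_mul_of_nonneg_left (norm_tmul_le v (h k)) (norm_nonneg F)
    have e : ∀ d, F (z d) = ∑ k, r k * g k (y d) := fun d => by
      simp only [hz, sumTmul, map_sum, smul_tmul', map_smul, smul_eq_mul]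
      rfl
    simp only [e]
    simpa using tendsto_finsetSum Finset.univ fun k _ => (hweak (g k)).const_mul (r k)
  have hmem : ∀ s : ℝ, |s| = 1 → ∀ᶠ d in l, (1 + (1 : ℝ) / (d.2 + 1))⁻¹ • (t + s • z d) ∈ B := by
    intro s hs
    have hT : Tendsto (fun d => toWeakSpace ℝ (ProjTensor X Y)
        ((1 + (1 : ℝ) / (d.2 + 1))⁻¹ • (t + s • z d))) l (𝓝 (toWeakSpace ℝ _ t)) := by
      refine tendsto_toWeakSpace fun F => ?_
      simp only [map_smul, map_add, smul_eq_mul]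
      simpa using hscale.mul (((hzF F).const_mul s).const_add (F t))
    filter_upwards [hT.eventually (hU.mem_nhds hxU)] with d hd
    refine ⟨?_, hd⟩
    have hd0 : 0 < 1 + (1 : ℝ) / (d.2 + 1) := by positivity
    rw [mem_closedBall_zero_iff, norm_smul, norm_inv, Real.norm_of_nonneg hd0.le,
      inv_mul_le_iff₀ hd0]
    have key := norm_sumTmul_add_smul_le (h := h) (hyx d) (r := r) (s := fun k => s * r k)
      (fun k => by rw [abs_mul, hs, one_mul, abs_of_nonneg (hr0 k)]) hxr
    rw [hsum] at key
    have e : (sumTmul h fun k => (s * r k) • y d) = s • z d := by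
      rw [hz, ← sumTmul_smul]
      simp only [mul_smul]
      rfl
    rwa [e] at key
  have hlim : Tendsto (fun d : Finset (StrongDual ℝ X) × ℕ => (1 + (1 : ℝ) / (d.2 + 1))⁻¹ * 2) l
      (𝓝 2) := by
    simpa using hscale.mul_const 2
  refine le_of_tendsto hlim ?_
  filter_upwards [hmem 1 (by simp), hmem (-1) (by simp)] with d h₁ h₂
  refine le_trans (le_of_eq ?_) (Metric.dist_le_diam_of_mem hbdd h₁ h₂)
  have hd0 : 0 < 1 + (1 : ℝ) / (d.2 + 1) := by positivity
  have e : t + (1 : ℝ) • z d - (t + (-1 : ℝ) • z d) = (2 : ℝ) • z d := by module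
  rw [dist_eq_norm, ← smul_sub, e, norm_smul, norm_smul, hzn, norm_inv,
    Real.norm_of_nonneg hd0.le]
  norm_num

end ProjTensor

end

/-- If `X` is a (nonzero) ASQ₊ Banach lattice and `Y` is an AL-space with `n(Y*, y*) = 1` for some
`y*` in the unit sphere of `Y*`, then the projective tensor product of `X` and `Y`, ordered by its
closed positive cone, is a Banach lattice; it is LASQ₊ and has the diameter two property. -/
theorem corollary3p4
    {X : Type*} [NormedAddCommGroup X] [NormedSpace ℝ X] [Lattice X] [IsBanachLattice X]
    [Nontrivial X]
    {Y : Type*} [NormedAddCommGroup Y] [NormedSpace ℝ Y] [Lattice Y] [IsBanachLattice Y]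
    (hX : IsASQPlus X) (hY : IsALSpace Y)
    (hn : ∃ φ : StrongDual ℝ Y, ‖φ‖ = 1 ∧ numericalIndex φ = 1) :
    ∃ _ : Lattice (ProjTensor X Y),
      (∀ z : ProjTensor X Y, 0 ≤ z ↔ z ∈ ProjTensor.positiveCone X Y) ∧
      IsBanachLattice (ProjTensor X Y) ∧
      IsLASQPlus (ProjTensor X Y) ∧
      HasDiameterTwoProperty (ProjTensor X Y) := by
  -- For a nonzero AL-space the norm functional always satisfies the index condition,
  -- so that `Y ≠ 0` is all that `hn` has to supply.
  have : Nontrivial Y := by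
    obtain ⟨φ, hφ, -⟩ := hn
    obtain ⟨y, hy⟩ := DFunLike.ne_iff.1 (norm_ne_zero_iff.1 (hφ.trans_ne one_ne_zero))
    exact ⟨y, 0, fun h => hy (by rw [h, map_zero]; rfl)⟩
  have hpos : ∀ z : ProjTensor X Y,
      (ProjTensor.lattice hY).le 0 z ↔ z ∈ ProjTensor.positiveCone X Y := fun z => by
    rw [ProjTensor.lattice_le_iff, sub_zero]
  refine ⟨ProjTensor.lattice hY, hpos, ProjTensor.isBanachLattice hY, fun u hu ε hε => ?_,
    ProjTensor.hasDiameterTwoProperty hX hY⟩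
  obtain ⟨z, hz, hz1, h1, h2⟩ := ProjTensor.exists_positive_norm_add_sub_le hX hY hu hε
  exact ⟨z, (hpos z).2 hz, hz1, h1, h2⟩
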